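/- **Theorem 2.5.** Let $\mathbb{RP}^2$ be the quotient of the unit sphere $S^2\subset\mathbb R^3$ by the antipodal map. Let $g_0$ be a round Riemannian metric of constant Gaussian curvature $+1$ on $\mathbb{RP}^2$, that is, one isometric to the metric for which the double covering $S^2\to\mathbb{RP}^2$ is a local isometry. Let $g$ be a (continuous, for instance smooth) Riemannian metric on $\mathbb{RP}^2$ and let $f\colon\mathbb{RP}^2\to(0,\infty)$ be a function such that $g=f^2g_0$. Let $L$ be the infimum of the $g$-lengths of the noncontractible $C^1$ loops in $\mathbb{RP}^2$ (closed paths that are $C^1$ on $[0,1]$, possibly with a corner at the base point); when a shortest such loop exists, $L$ is its length. Let $\mu=\frac1{2\pi}\,\mathrm{area}_{g_0}$, where $\mathrm{area}_{g_0}$ is the Riemannian area measure of $g_0$. Then $\mathrm{area}(g)$ and $L$ are finite, $\mu$ is a probability measure, $f\in L^2(\mu)$, and $$\mathrm{area}(g)-\frac{2L^2}{\pi}\ \geq\ 2\pi\,\mathrm{Var}_\mu(f).$$ Furthermore, equality $\mathrm{area}(g)=\frac{2L^2}{\pi}$ holds if and only if $f$ is constant. -/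

import Mathlib

open scoped Manifold ContDiff ENNReal Bundle
open Set MeasureTheory

noncomputable section

/-! ### The unit sphere and the real projective plane -/

/-- The unit sphere of Euclidean `3`-space, with Mathlib's manifold structure. -/
abbrev S2 : Type := Metric.sphere (0 : EuclideanSpace ℝ (Fin 3)) 1

/-- The two-element group `{1, -1}`, as the unit sphere of `ℝ`; it acts on `S2` by
multiplication, `-1` acting as the antipodal map. -/
abbrev PlusMinusOne : Type := Metric.sphere (0 : ℝ) 1

theorem PlusMinusOne.eq_or (u : PlusMinusOne) : u = 1 ∨ u = -1 := by
  have h : |(u : ℝ)| = 1 := mem_sphere_zero_iff_norm.1 u.2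
  rcases (abs_eq zero_le_one).1 h with h | h
  · exact Or.inl (Subtype.ext h)
  · exact Or.inr (Subtype.ext h)

instance : Finite PlusMinusOne :=
  Finite.of_surjective (fun b : Bool => if b then (1 : PlusMinusOne) else -1) fun u => by
    rcases u.eq_or with h | h
    · exact ⟨true, by simp [h]⟩
    · exact ⟨false, by simp [h]⟩

theorem PlusMinusOne.neg_one_smul (x : S2) : (-1 : PlusMinusOne) • x = -x :=
  Subtype.ext (by
    change ((-1 : ℝ)) • (x : EuclideanSpace ℝ (Fin 3)) = -(x : EuclideanSpace ℝ (Fin 3))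
    simp)

instance : IsCancelSMul PlusMinusOne S2 where
  left_cancel' u x y h := by
    simpa using congrArg (fun z => u⁻¹ • z) h
  right_cancel' u v x h := by
    have hx := ne_neg_of_mem_unit_sphere ℝ x
    rcases u.eq_or with rfl | rfl <;> rcases v.eq_or with rfl | rfl
    · rfl
    · rw [one_smul, PlusMinusOne.neg_one_smul] at h
      exact absurd h hx
    · rw [one_smul, PlusMinusOne.neg_one_smul] at h
      exact absurd h.symm hx
    · rfl

/-- The real projective plane: the quotient of the unit sphere by the antipodal map. -/
def RP2 : Type := MulAction.orbitRel.Quotient PlusMinusOne S2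

namespace RP2

instance : TopologicalSpace RP2 :=
  inferInstanceAs (TopologicalSpace (MulAction.orbitRel.Quotient PlusMinusOne S2))

/-- The charts of `RP2` are local inverses of the quotient map followed by charts of `S2`. -/
instance : ChartedSpace (EuclideanSpace ℝ (Fin 2)) RP2 :=
  inferInstanceAs (ChartedSpace (EuclideanSpace ℝ (Fin 2))
    (MulAction.orbitRel.Quotient PlusMinusOne S2))

instance : MeasurableSpace RP2 := borel RP2

instance : BorelSpace RP2 := ⟨rfl⟩

/-- The quotient map `S2 → RP2`. -/
def proj (x : S2) : RP2 := Quotient.mk _ x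

theorem proj_surjective : Function.Surjective proj := Quotient.mk_surjective

theorem proj_eq_iff {x y : S2} : proj x = proj y ↔ x = y ∨ x = -y := by
  have h : proj x = proj y ↔ x ∈ MulAction.orbit PlusMinusOne y := Quotient.eq
  rw [h]
  constructor
  · rintro ⟨u, rfl⟩
    rcases u.eq_or with rfl | rfl
    · exact Or.inl (one_smul _ _)
    · exact Or.inr (PlusMinusOne.neg_one_smul _)
  · rintro (rfl | rfl)
    · exact MulAction.mem_orbit_self (M := PlusMinusOne) _
    · exact ⟨-1, PlusMinusOne.neg_one_smul _⟩

theorem isCoveringMap_proj : IsCoveringMap proj :=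
  IsQuotientCoveringMap.isCoveringMap _ PlusMinusOne
    (isQuotientCoveringMap_quotientMk_of_properlyDiscontinuousSMul
      (G := PlusMinusOne) (E := S2))

theorem isLocalHomeomorph_proj : IsLocalHomeomorph proj :=
  isCoveringMap_proj.isLocalHomeomorph

instance finrank_fact : Fact (Module.finrank ℝ (EuclideanSpace ℝ (Fin 3)) = 2 + 1) :=
  ⟨by simp⟩

theorem exists_localInverse_comp_proj (L : OpenPartialHomeomorph RP2 S2) (hL : L.symm = proj)
    {s : S2} (hs : proj s ∈ L.source) :
    ∃ σ : S2 → S2, ContMDiff (𝓡 2) (𝓡 2) ω σ ∧ L (proj s) = σ s ∧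
      (fun t => L (proj t)) =ᶠ[nhds s] σ := by
  have key : ∀ σ : S2 → S2, Continuous σ → (∀ t, proj (σ t) = proj t) → L (proj s) = σ s →
      (fun t => L (proj t)) =ᶠ[nhds s] σ := by
    intro σ hσ hp h
    have hmem : σ s ∈ L.target := h ▸ L.map_source hs
    filter_upwards [hσ.continuousAt.preimage_mem_nhds (L.open_target.mem_nhds hmem)] with t ht
    have := L.right_inv ht
    rw [hL, hp] at this
    exact this
  have h : proj (L (proj s)) = proj s := by
    have := L.left_inv hs
    rwa [hL] at this
  rcases proj_eq_iff.1 h with h | h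
  · exact ⟨id, contMDiff_id, h, key _ continuous_id (fun _ => rfl) h⟩
  · exact ⟨fun x => -x, contMDiff_neg_sphere, h,
      key _ continuous_neg (fun t => proj_eq_iff.2 (Or.inr rfl)) h⟩

theorem exists_chart_eq {e : OpenPartialHomeomorph RP2 (EuclideanSpace ℝ (Fin 2))}
    (he : e ∈ atlas (EuclideanSpace ℝ (Fin 2)) RP2) :
    ∃ (L : OpenPartialHomeomorph RP2 S2) (x : S2), L.symm = proj ∧
      e = L.trans (chartAt (EuclideanSpace ℝ (Fin 2)) x) := by
  obtain ⟨q, rfl⟩ := he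
  exact ⟨_, _, isLocalHomeomorph_proj.localInverseAt_symm _, rfl⟩

instance : IsManifold (𝓡 2) ω RP2 := by
  refine isManifold_of_contDiffOn _ _ _ ?_
  intro e e' he he'
  obtain ⟨L, x, hL, rfl⟩ := exists_chart_eq he
  obtain ⟨L', x', hL', rfl⟩ := exists_chart_eq he'
  intro y hy
  simp only [modelWithCornersSelf_coe, modelWithCornersSelf_coe_symm, preimage_id,
    range_id, inter_univ, Function.comp_id, Function.id_comp] at hy ⊢
  simp only [OpenPartialHomeomorph.trans_source, OpenPartialHomeomorph.trans_symm_eq_symm_trans_symm,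
    OpenPartialHomeomorph.symm_source, mem_inter_iff, mem_preimage,
    OpenPartialHomeomorph.coe_trans, Function.comp_apply, hL] at hy
  obtain ⟨⟨hy1, hy2⟩, hy3, hy4⟩ := hy
  obtain ⟨σ, hσ, hσs, hev⟩ := exists_localInverse_comp_proj L' hL' hy3
  rw [hσs] at hy4
  have h1 : ContMDiffAt (𝓡 2) (𝓡 2) ω (chartAt (EuclideanSpace ℝ (Fin 2)) x).symm y :=
    (contMDiffOn_chart_symm (I := 𝓡 2) (n := ω) (x := x)).contMDiffAt
      ((chartAt (EuclideanSpace ℝ (Fin 2)) x).open_target.mem_nhds hy1)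
  have h3 : ContMDiffAt (𝓡 2) (𝓡 2) ω (chartAt (EuclideanSpace ℝ (Fin 2)) x')
      (σ ((chartAt (EuclideanSpace ℝ (Fin 2)) x).symm y)) :=
    (contMDiffOn_chart (I := 𝓡 2) (n := ω) (x := x')).contMDiffAt
      ((chartAt (EuclideanSpace ℝ (Fin 2)) x').open_source.mem_nhds hy4)
  have h : ContMDiffAt (𝓡 2) (𝓡 2) ω
      (chartAt (EuclideanSpace ℝ (Fin 2)) x' ∘ σ ∘ (chartAt (EuclideanSpace ℝ (Fin 2)) x).symm) y :=
    h3.comp y (hσ.contMDiffAt.comp y h1)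
  refine ((contMDiffAt_iff_contDiffAt.1 h).congr_of_eventuallyEq ?_).contDiffWithinAt
  filter_upwards [h1.continuousAt.eventually hev] with z hz
  simp only [OpenPartialHomeomorph.trans_symm_eq_symm_trans_symm,
    OpenPartialHomeomorph.coe_trans, Function.comp_apply, hL]
  rw [hz]

/-- The quotient map is smooth (indeed analytic). -/
theorem contMDiff_proj : ContMDiff (𝓡 2) (𝓡 2) ω proj := by
  intro s
  rw [contMDiffAt_iff_target]
  refine ⟨isLocalHomeomorph_proj.continuous.continuousAt, ?_⟩
  obtain ⟨L, x, hL, hc⟩ := exists_chart_eq (chart_mem_atlas (EuclideanSpace ℝ (Fin 2)) (proj s))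
  have hs := mem_chart_source (EuclideanSpace ℝ (Fin 2)) (proj s)
  simp only [extChartAt, hc, OpenPartialHomeomorph.trans_source, mem_inter_iff, mem_preimage] at hs ⊢
  obtain ⟨σ, hσ, hσs, hev⟩ := exists_localInverse_comp_proj L hL hs.1
  rw [hσs] at hs
  have h3 : ContMDiffAt (𝓡 2) (𝓡 2) ω (chartAt (EuclideanSpace ℝ (Fin 2)) x) (σ s) :=
    (contMDiffOn_chart (I := 𝓡 2) (n := ω) (x := x)).contMDiffAt
      ((chartAt (EuclideanSpace ℝ (Fin 2)) x).open_source.mem_nhds hs.2)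
  refine (h3.comp s hσ.contMDiffAt).congr_of_eventuallyEq ?_
  filter_upwards [hev] with z hz
  simp only [Function.comp_apply] at hz ⊢
  rw [← hz]
  rfl

end RP2

/-! ### Riemannian metrics on surfaces: lengths and areas -/

section Surface

/-- A (continuous) Riemannian metric on a surface `M`: a scalar product on each tangent space
that depends continuously on the point. -/
abbrev SurfaceMetric (M : Type*) [TopologicalSpace M]
    [ChartedSpace (EuclideanSpace ℝ (Fin 2)) M] [IsManifold (𝓡 2) 1 M] :=
  Bundle.ContinuousRiemannianMetric (EuclideanSpace ℝ (Fin 2))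
    (fun x : M => TangentSpace (𝓡 2) x)

namespace SurfaceMetric

variable {M : Type*} [TopologicalSpace M] [ChartedSpace (EuclideanSpace ℝ (Fin 2)) M]
  [IsManifold (𝓡 2) 1 M]

/-- The `g`-length of a (continuously differentiable) path: the integral over `[0, 1]` of the
`g`-norm of its velocity. -/
def pathLength (g : SurfaceMetric M) {p q : M} (γ : Path p q) : ℝ≥0∞ :=
  letI : Bundle.RiemannianBundle (fun x : M => TangentSpace (𝓡 2) x) := ⟨g.toRiemannianMetric⟩
  Manifold.pathELength (𝓡 2) γ.extend 0 1

/-- The infimum of the `g`-lengths of the noncontractible `C^1` loops. (A loop is `C^1` as a path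
on `[0, 1]`; it may have a corner at its base point. Every piecewise `C^1` loop becomes one of
these after a reparametrization that stops at the corners, which does not affect its length.) -/
def systole (g : SurfaceMetric M) : ℝ≥0∞ :=
  ⨅ (p : M) (γ : Path p p) (_ : ContMDiffOn 𝓘(ℝ, ℝ) (𝓡 2) 1 γ.extend (Icc 0 1))
    (_ : ¬ γ.Homotopic (Path.refl p)), g.pathLength γ

/-- The coefficient `g_ij` of `g` in the local coordinates given by the chart `φ`, at the point
with coordinates `y`. -/
def coeff (g : SurfaceMetric M) (φ : OpenPartialHomeomorph M (EuclideanSpace ℝ (Fin 2)))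
    (y : EuclideanSpace ℝ (Fin 2)) (i j : Fin 2) : ℝ :=
  g.inner (φ.symm y)
    (mfderiv (𝓡 2) (𝓡 2) φ.symm y (EuclideanSpace.single i (1 : ℝ) : EuclideanSpace ℝ (Fin 2)))
    (mfderiv (𝓡 2) (𝓡 2) φ.symm y (EuclideanSpace.single j (1 : ℝ) : EuclideanSpace ℝ (Fin 2)))

/-- The area measure of `g` on the domain of the chart `φ`: in coordinates it has density
`√(det g_ij)` with respect to Lebesgue measure. -/
def chartArea [MeasurableSpace M] (g : SurfaceMetric M)
    (φ : OpenPartialHomeomorph M (EuclideanSpace ℝ (Fin 2))) : Measure M :=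
  ((volume.restrict φ.target).withDensity
    fun y => ENNReal.ofReal √(Matrix.of (g.coeff φ y)).det).map φ.symm

/-- The area measure of `g`: the measure obtained by gluing the area measures on the chart domains.
As these agree on overlaps, the glued measure is their supremum. -/
def area [MeasurableSpace M] (g : SurfaceMetric M) : Measure M :=
  ⨆ φ ∈ atlas (EuclideanSpace ℝ (Fin 2)) M, g.chartArea φ

end SurfaceMetric

end Surface

/-- A metric on `RP2` is round, of curvature `+1`, if it is isometric to the metric induced by the
unit sphere: for some diffeomorphism `φ` of `RP2`, the double covering `φ ∘ proj` from `S2` (with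
the metric induced by Euclidean space) is a local isometry. -/
def IsRound (g₀ : SurfaceMetric RP2) : Prop :=
  ∃ φ : RP2 ≃ₘ^∞⟮𝓡 2, 𝓡 2⟯ RP2, ∀ (x : S2) (v w : TangentSpace (𝓡 2) x),
    g₀.inner (φ (RP2.proj x))
      (mfderiv (𝓡 2) (𝓡 2) (fun y : S2 => φ (RP2.proj y)) x v)
      (mfderiv (𝓡 2) (𝓡 2) (fun y : S2 => φ (RP2.proj y)) x w) =
    inner ℝ
      (mvfderiv (𝓡 2) (fun y : S2 => (y : EuclideanSpace ℝ (Fin 3))) x v)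
      (mvfderiv (𝓡 2) (fun y : S2 => (y : EuclideanSpace ℝ (Fin 3))) x w)

/-- The measure `(1 / 2π) · area` of a metric; for a round metric on `RP2` this is a probability
measure. -/
def normalizedArea (g₀ : SurfaceMetric RP2) : Measure RP2 :=
  ENNReal.ofReal (1 / (2 * Real.pi)) • g₀.area

end

open scoped Manifold ContDiff ENNReal Bundle Pointwise Topology
open Set MeasureTheory RP2

/-! Write E for the mean with respect to `normalizedArea g₀`. Since `g = f² g₀` in dimension two,
area densities scale by `f²`, so area(g) = 2π E[f²] (`SurfaceMetric.area_of_conformal`).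

A great semicircle joins antipodal points of the sphere, so it covers a noncontractible loop.
Parametrized at constant speed π, its image has g-length π ∫ f along the semicircle, and this bounds
L from above. Averaging over all rotated and reflected copies of one semicircle turns the curve
integral into an integral over the sphere (`mul_le_lintegral_sphereArea`, an integral-geometric
Fubini argument), hence L ≤ π E[f] (`IsRoundVia.systole_le`). Therefore area(g) - 2L²/π ≥ 2π(E[f²] -
E[f]²) = 2π Var(f).

If the left side vanishes, so does the variance, and f is constant almost everywhere, hence
everywhere by continuity. Conversely, if f = c then L = cπ, because every noncontractible loop has
round length at least π: its lift to the sphere reaches the antipode of its starting point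
(`homotopic_of_lift_ne_neg`), and a spherical curve between antipodes has length at least π
(`pi_le_length_of_antipodal`).

What links the two sides is that the area of g₀, defined through charts, is half the image of the
spherical measure (`IsRoundVia.area_eq`). This rests on computing the measure of a parametrized
spherical patch from the volume of the cone over it (`toSphere_image`). -/

noncomputable section

local notation "E2" => EuclideanSpace ℝ (Fin 2)

local notation "E3" => EuclideanSpace ℝ (Fin 3)

/-! ### Lengths, areas and conformal change of metric -/

namespace SurfaceMetric

variable {M : Type*} [TopologicalSpace M] [ChartedSpace E2 M]
  [IsManifold (𝓡 2) 1 M]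

/-- The speed of a curve with respect to `g`. -/
def speed (g : SurfaceMetric M) (γ : ℝ → M) (t : ℝ) : ℝ :=
  √(g.inner (γ t) (mfderiv 𝓘(ℝ, ℝ) (𝓡 2) γ t (1 : ℝ)) (mfderiv 𝓘(ℝ, ℝ) (𝓡 2) γ t (1 : ℝ)))

theorem pathLength_eq (g : SurfaceMetric M) {p q : M} (γ : Path p q) :
    g.pathLength γ = ∫⁻ t in Ioo (0 : ℝ) 1, ENNReal.ofReal (g.speed γ.extend t) := by
  let _ : Bundle.RiemannianBundle (fun x : M => TangentSpace (𝓡 2) x) := ⟨g.toRiemannianMetric⟩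
  rw [pathLength, Manifold.pathELength_eq_lintegral_mfderiv_Ioo]
  refine lintegral_congr fun t => ?_
  rw [← ofReal_norm, norm_eq_sqrt_real_inner]
  rfl

theorem continuousAt_inner (g : SurfaceMetric M) (x : M) (v : E2) :
    ContinuousAt (fun y => g.inner y
      ((trivializationAt E2 (fun x : M => TangentSpace (𝓡 2) x) x).symm y v)
      ((trivializationAt E2 (fun x : M => TangentSpace (𝓡 2) x) x).symm y v)) x := by
  let _ : Bundle.RiemannianBundle (fun x : M => TangentSpace (𝓡 2) x) := ⟨g.toRiemannianMetric⟩
  have h : ContinuousAt (fun y =>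
      (⟨y, (trivializationAt E2 (fun x : M => TangentSpace (𝓡 2) x) x).symm y v⟩ :
      Bundle.TotalSpace E2 (fun x : M => TangentSpace (𝓡 2) x))) x := by
    set e := trivializationAt E2 (fun x : M => TangentSpace (𝓡 2) x) x
    have h1 := e.continuousOn_symm
    have hx : x ∈ e.baseSet := FiberBundle.mem_baseSet_trivializationAt' x
    have h2 := (h1.continuousAt (x := (x, v))
      ((e.open_baseSet.prod isOpen_univ).mem_nhds ⟨hx, mem_univ _⟩)).comp
      (f := fun y : M => (y, v)) (x := x) (by fun_prop)
    exact h2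
  exact h.inner_bundle h

/-- Along a nonvanishing continuous local vector field v, f is the square root of the quotient
g(v,v) / g₀(v,v) of continuous functions. The field comes from a local trivialization of the tangent
bundle. -/
theorem continuous_of_conformal {g₀ g : SurfaceMetric M} {f : M → ℝ} (hf : ∀ x, 0 < f x)
    (hg : ∀ (x : M) (v w : TangentSpace (𝓡 2) x), g.inner x v w = f x ^ 2 * g₀.inner x v w) :
    Continuous f := by
  rw [continuous_iff_continuousAt]
  intro x
  set e := trivializationAt E2 (fun x : M => TangentSpace (𝓡 2) x) x
  have hx : x ∈ e.baseSet := FiberBundle.mem_baseSet_trivializationAt' x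
  have hne : ∀ y ∈ e.baseSet, e.symm y (EuclideanSpace.single 0 1) ≠ 0 := by
    intro y hy h0
    have h3 := congrArg (e.continuousLinearMapAt ℝ y) h0
    rw [map_zero] at h3
    have h4 := e.continuousLinearMapAt_symmL (R := ℝ) hy (EuclideanSpace.single 0 1)
    rw [Bundle.Trivialization.symmL_apply] at h4
    rw [h4] at h3
    · simpa using congrArg (fun z => z.ofLp 0) h3
    · exact hy
  have h := ((g.continuousAt_inner x (EuclideanSpace.single 0 1)).div
    (g₀.continuousAt_inner x (EuclideanSpace.single 0 1)) (g₀.pos x _ (hne x hx)).ne').sqrt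
  refine h.congr ?_
  filter_upwards [e.open_baseSet.mem_nhds hx] with y hy
  rw [Pi.div_apply, hg, mul_div_cancel_right₀ _ (g₀.pos y _ (hne y hy)).ne', Real.sqrt_sq (hf y).le]

theorem continuousOn_coeff (g : SurfaceMetric M)
    {φ : OpenPartialHomeomorph M E2}
    (hφ : φ ∈ atlas E2 M) (i j : Fin 2) :
    ContinuousOn (fun y => g.coeff φ y i j) φ.target := by
  let _ : Bundle.RiemannianBundle (fun x : M => TangentSpace (𝓡 2) x) := ⟨g.toRiemannianMetric⟩
  have h1 : ContMDiffOn (𝓡 2) (𝓡 2) 1 φ.symm φ.target :=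
    contMDiffOn_symm_of_mem_maximalAtlas (IsManifold.subset_maximalAtlas hφ)
  have h2 := h1.continuousOn_tangentMapWithin le_rfl φ.open_target.uniqueMDiffOn
  have h3 : ∀ i : Fin 2, ContinuousOn (fun y =>
      (⟨φ.symm y, mfderiv (𝓡 2) (𝓡 2) φ.symm y (EuclideanSpace.single i (1 : ℝ) : E2)⟩ :
      Bundle.TotalSpace E2 (fun x : M => TangentSpace (𝓡 2) x))) φ.target := by
    intro i
    have h4 : ContinuousOn (fun y : E2 =>
        (⟨y, EuclideanSpace.single i (1 : ℝ)⟩ : TangentBundle (𝓡 2) E2)) φ.target := by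
      refine Continuous.continuousOn ?_
      have := (tangentBundleModelSpaceHomeomorph (𝓡 2)).symm.continuous.comp
        (f := fun y : E2 => ((y, EuclideanSpace.single i (1 : ℝ)) : ModelProd _ _))
        (Continuous.prodMk continuous_id continuous_const)
      exact this
    have h5 := h2.comp h4 (fun y hy => hy)
    refine h5.congr fun y hy => ?_
    simp only [Function.comp_apply, tangentMapWithin]
    rw [mfderivWithin_of_mem_nhds (φ.open_target.mem_nhds hy)]
  exact (h3 i).inner_bundle (h3 j)

theorem aemeasurable_areaDensity (g : SurfaceMetric M)
    {φ : OpenPartialHomeomorph M E2}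
    (hφ : φ ∈ atlas E2 M) :
    AEMeasurable (fun y => ENNReal.ofReal √(Matrix.of (g.coeff φ y)).det)
      (volume.restrict φ.target) := by
  have h : ContinuousOn (fun y => ENNReal.ofReal √(Matrix.of (g.coeff φ y)).det) φ.target := by
    refine ENNReal.continuous_ofReal.comp_continuousOn
      (Continuous.comp_continuousOn Real.continuous_sqrt ?_)
    simp only [Matrix.det_fin_two, Matrix.of_apply]
    exact ((g.continuousOn_coeff hφ 0 0).mul (g.continuousOn_coeff hφ 1 1)).sub
      ((g.continuousOn_coeff hφ 0 1).mul (g.continuousOn_coeff hφ 1 0))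
  exact h.aemeasurable φ.open_target.measurableSet

/-- The determinant of the 2 × 2 coefficient matrix scales by f⁴, so its square root scales by f².
-/
theorem chartArea_of_conformal [MeasurableSpace M] [BorelSpace M] {g₀ g : SurfaceMetric M}
    {f : M → ℝ} (hf : ∀ x, 0 < f x)
    (hg : ∀ (x : M) (v w : TangentSpace (𝓡 2) x), g.inner x v w = f x ^ 2 * g₀.inner x v w)
    {φ : OpenPartialHomeomorph M E2}
    (hφ' : φ ∈ atlas E2 M) :
    g.chartArea φ = (g₀.chartArea φ).withDensity fun x => ENNReal.ofReal (f x ^ 2) := by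
  have hc := continuous_of_conformal hf hg
  have hφ : AEMeasurable φ.symm (volume.restrict φ.target) :=
    φ.continuousOn_symm.aemeasurable φ.open_target.measurableSet
  have hm : Measurable fun x => ENNReal.ofReal (f x ^ 2) := by fun_prop
  have hφ2 : AEMeasurable φ.symm ((volume.restrict φ.target).withDensity
    fun y => ENNReal.ofReal √(Matrix.of (g₀.coeff φ y)).det) :=
    hφ.mono_ac (withDensity_absolutelyContinuous _ _)
  have hφ3 : AEMeasurable φ.symm ((volume.restrict φ.target).withDensity
    fun y => ENNReal.ofReal √(Matrix.of (g.coeff φ y)).det) :=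
    hφ.mono_ac (withDensity_absolutelyContinuous _ _)
  have hdet : ∀ y, ENNReal.ofReal √(Matrix.of (g.coeff φ y)).det =
      ENNReal.ofReal √(Matrix.of (g₀.coeff φ y)).det * ENNReal.ofReal (f (φ.symm y) ^ 2) := by
    intro y
    have h1 : (Matrix.of (g.coeff φ y)).det =
        (Matrix.of (g₀.coeff φ y)).det * (f (φ.symm y) ^ 2) ^ 2 := by
      simp only [Matrix.det_fin_two, Matrix.of_apply, coeff, hg]
      ring
    rw [← ENNReal.ofReal_mul (Real.sqrt_nonneg _), h1, Real.sqrt_mul' _ (by positivity),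
      Real.sqrt_sq (sq_nonneg _)]
  ext s hs
  rw [withDensity_apply _ hs, chartArea, Measure.map_apply_of_aemeasurable hφ3 hs, chartArea,
    Measure.restrict_map_of_aemeasurable hφ2 hs,
    lintegral_map' hm.aemeasurable (hφ2.mono_measure Measure.restrict_le_self)]
  rw [restrict_withDensity', withDensity_apply',
    lintegral_withDensity_eq_lintegral_mul₀ ((g₀.aemeasurable_areaDensity hφ').mono_measure
      Measure.restrict_le_self)
      (g := fun y => ENNReal.ofReal (f (φ.symm y) ^ 2))
      ((hm.comp_aemeasurable hφ).mono_measure Measure.restrict_le_self)]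
  exact lintegral_congr fun y => hdet y

theorem withDensity_mono_measure {α : Type*} [MeasurableSpace α] {μ ν : Measure α} (h : μ ≤ ν)
    (k : α → ℝ≥0∞) : μ.withDensity k ≤ ν.withDensity k := by
  refine Measure.le_iff.2 fun s hs => ?_
  rw [withDensity_apply _ hs, withDensity_apply _ hs]
  exact lintegral_mono' (Measure.restrict_mono_measure h s) le_rfl

/-- Multiplication by a density with values in (0, ∞) is monotone on measures, with monotone inverse
the multiplication by `k⁻¹`. As an order isomorphism it preserves suprema. -/
theorem withDensity_iSup₂ {α ι : Type*} [MeasurableSpace α] {p : ι → Prop}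
    (μ : ∀ i, p i → Measure α)
    {k : α → ℝ≥0∞} (hk : Measurable k) (h0 : ∀ x, k x ≠ 0) (hT : ∀ x, k x ≠ ⊤) :
    (⨆ (i) (hi : p i), μ i hi).withDensity k = ⨆ (i) (hi : p i), (μ i hi).withDensity k := by
  have key : ∀ ν : Measure α, (ν.withDensity k).withDensity (fun x => (k x)⁻¹) = ν := fun ν => by
    change (ν.withDensity k).withDensity k⁻¹ = ν
    rw [← withDensity_mul _ hk hk.inv]
    have : k * k⁻¹ = 1 := by
      ext x; exact ENNReal.mul_inv_cancel (h0 x) (hT x)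
    rw [this, withDensity_one]
  have key2 : ∀ ν : Measure α, (ν.withDensity (fun x => (k x)⁻¹)).withDensity k = ν := fun ν => by
    change (ν.withDensity k⁻¹).withDensity k = ν
    rw [← withDensity_mul _ hk.inv hk]
    have : k⁻¹ * k = 1 := by
      ext x; exact ENNReal.inv_mul_cancel (h0 x) (hT x)
    rw [this, withDensity_one]
  apply le_antisymm
  · rw [← key2 (⨆ (i) (hi : p i), (μ i hi).withDensity k)]
    refine withDensity_mono_measure ?_ k
    refine iSup₂_le fun i hi => ?_
    rw [← key (μ i hi)]
    exact withDensity_mono_measure (le_iSup₂ (f := fun i hi => (μ i hi).withDensity k) i hi) _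
  · exact iSup₂_le fun i hi => withDensity_mono_measure (le_iSup₂ (f := μ) i hi) k

theorem area_of_conformal [MeasurableSpace M] [BorelSpace M] {g₀ g : SurfaceMetric M}
    {f : M → ℝ} (hf : ∀ x, 0 < f x)
    (hg : ∀ (x : M) (v w : TangentSpace (𝓡 2) x), g.inner x v w = f x ^ 2 * g₀.inner x v w) :
    g.area = g₀.area.withDensity fun x => ENNReal.ofReal (f x ^ 2) := by
  have hc := continuous_of_conformal hf hg
  rw [area, area, withDensity_iSup₂ _ (by fun_prop)
    (fun x => by simpa using (hf x).ne') (fun x => ENNReal.ofReal_ne_top)]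
  exact iSup_congr fun φ => iSup_congr fun hφ => chartArea_of_conformal hf hg hφ

end SurfaceMetric

/-! ### Spherical area through cones over patches -/

/-- Dropping the first coordinate, `(z₀, z₁, z₂) ↦ (z₁, z₂)`. -/
def dropFirst : E3 →L[ℝ] E2 :=
  (EuclideanSpace.equiv (Fin 2) ℝ).symm.toContinuousLinearMap.comp
    (ContinuousLinearMap.pi fun i => EuclideanSpace.proj (Fin.succ i))

theorem dropFirst_apply (z : E3) (i : Fin 2) :
    dropFirst z i = z i.succ := rfl

/-- Splitting off the first coordinate, `(z₀, z₁, z₂) ↦ (z₀, (z₁, z₂))`. -/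
def splitFirst : E3 ≃ᵐ ℝ × E2 :=
  ((MeasurableEquiv.toLp 2 (Fin 3 → ℝ)).symm.trans
    (MeasurableEquiv.piFinSuccAbove (fun _ : Fin 3 => ℝ) 0)).trans
      ((MeasurableEquiv.refl ℝ).prodCongr (MeasurableEquiv.toLp 2 (Fin 2 → ℝ)))

theorem splitFirst_apply (z : E3) : splitFirst z = (z 0, dropFirst z) := rfl

theorem measurePreserving_splitFirst : MeasurePreserving splitFirst volume volume := by
  have h1 := PiLp.volume_preserving_ofLp (Fin 3)
  have h2 := volume_preserving_piFinSuccAbove (fun _ : Fin 3 => ℝ) 0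
  have h3 := (MeasurePreserving.id (volume : Measure ℝ)).prod (PiLp.volume_preserving_toLp (Fin 2))
  exact h3.comp (h2.comp h1)

/-- The Gram determinant of the partial derivatives of a map from the plane. -/
def gramDet (H : E2 → E3)
    (y : E2) : ℝ :=
  (Matrix.gram ℝ fun i : Fin 2 => fderiv ℝ H y (EuclideanSpace.single i 1)).det

theorem measurable_gramDet (H : E2 → E3) :
    Measurable (gramDet H) := by
  have h : ∀ i : Fin 2, Measurable fun y => fderiv ℝ H y (EuclideanSpace.single i 1) := fun i =>
    measurable_fderiv_apply_const ℝ H _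
  unfold gramDet
  simp only [Matrix.det_fin_two, Matrix.gram_apply]
  exact (((h 0).inner (h 0)).mul ((h 1).inner (h 1))).sub
    (((h 0).inner (h 1)).mul ((h 1).inner (h 0)))

/-- The derivative of the cone map `z ↦ z₀ • H (z₁, z₂)`. -/
def coneDeriv (H : E2 → E3)
    (z : E3) : E3 →L[ℝ] E3 :=
  z 0 • (fderiv ℝ H (dropFirst z)).comp dropFirst +
    (EuclideanSpace.proj 0 : E3 →L[ℝ] ℝ).smulRight (H (dropFirst z))

theorem hasFDerivAt_cone {H : E2 → E3}
    {z : E3} (h : DifferentiableAt ℝ H (dropFirst z)) :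
    HasFDerivAt (fun z : E3 => z 0 • H (dropFirst z)) (coneDeriv H z) z :=
  (EuclideanSpace.proj (𝕜 := ℝ) (0 : Fin 3)).hasFDerivAt.smul
    (h.hasFDerivAt.comp z dropFirst.hasFDerivAt)

theorem inner_fderiv_of_norm_eq_one {H : E2 → E3}
    (hH : ∀ y, ‖H y‖ = 1) {y : E2} (h : DifferentiableAt ℝ H y)
    (v : E2) : inner ℝ (H y) (fderiv ℝ H y v) = 0 := by
  have h1 := h.hasFDerivAt.inner ℝ h.hasFDerivAt
  have h2 : (fun t => inner ℝ (H t) (H t)) = fun _ => (1 : ℝ) := by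
    ext t; rw [real_inner_self_eq_norm_sq, hH]; norm_num
  rw [h2] at h1
  have h3 := congrArg (fun L => L v) (h1.unique (hasFDerivAt_const (1 : ℝ) y))
  simp [fderivInnerCLM_apply] at h3
  rw [real_inner_comm (H y)] at h3
  linarith

/-- As H has unit length, it is orthogonal to its derivatives. The Gram matrix of the columns of the
cone derivative thus splits into the entry 1 and z₀² times the Gram matrix of H; its determinant is
the square of the Jacobian. -/
theorem abs_det_coneDeriv {H : E2 → E3}
    (hH : ∀ y, ‖H y‖ = 1) {z : E3}
    (h : DifferentiableAt ℝ H (dropFirst z)) :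
    |(coneDeriv H z).det| = z 0 ^ 2 * √(gramDet H (dropFirst z)) := by
  set A := coneDeriv H z
  set b := EuclideanSpace.basisFun (Fin 3) ℝ
  have hA : ∀ v, A v = z 0 • fderiv ℝ H (dropFirst z) (dropFirst v) + v 0 • H (dropFirst z) :=
    fun v => rfl
  have h0 : dropFirst (b 0) = 0 := by
    ext i; simp [dropFirst_apply, b]
  have h1 : ∀ i : Fin 2, dropFirst (b i.succ) = EuclideanSpace.single i 1 := by
    intro i; ext j; simp [dropFirst_apply, b]
  have e0 : A (b 0) = H (dropFirst z) := by rw [hA, h0]; simp [b]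
  have e1 : ∀ i : Fin 2, A (b i.succ) =
      z 0 • fderiv ℝ H (dropFirst z) (EuclideanSpace.single i 1) := by
    intro i; rw [hA, h1]; simp [b]
  have hdet : A.det ^ 2 = (Matrix.gram ℝ fun i => A (b i)).det := by
    rw [Matrix.gram_eq_conjTranspose_mul b, Matrix.det_mul, Matrix.det_conjTranspose]
    have : A.det = (Matrix.of fun i j => b.repr (A (b j)) i).det := by
      change LinearMap.det (A : E3 →ₗ[ℝ] E3) = _
      rw [← LinearMap.det_toMatrix b.toBasis]
      congr 1
      ext i j
      simp [LinearMap.toMatrix_apply]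
    rw [this]
    simp [sq]
  have hg : (Matrix.gram ℝ fun i => A (b i)).det = (z 0 ^ 2) ^ 2 * gramDet H (dropFirst z) := by
    have f1 : A (b 1) = _ := e1 0
    have f2 : A (b 2) = _ := e1 1
    have g := inner_fderiv_of_norm_eq_one hH h
    have g' : ∀ v, inner ℝ (fderiv ℝ H (dropFirst z) v) (H (dropFirst z)) = 0 := fun v => by
      rw [real_inner_comm, g]
    have gn : inner ℝ (H (dropFirst z)) (H (dropFirst z)) = 1 := by
      rw [real_inner_self_eq_norm_sq, hH]; norm_num
    simp only [Matrix.det_fin_three, Matrix.gram_apply, e0, f1, f2, gramDet, Matrix.det_fin_two,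
      inner_smul_left, inner_smul_right, g, g', gn]
    simp
    ring
  rw [← Real.sqrt_sq_eq_abs, hdet, hg, Real.sqrt_mul (by positivity), Real.sqrt_sq (by positivity)]

/-- The spherical measure of a set is three times the volume of the cone over it. Change of
variables for `z ↦ z₀ • H (z₁, z₂)` separates the radial integral ∫₀¹ r² dr = 1/3, which cancels the
factor 3. -/
theorem toSphere_image {H : E2 → S2} {B : Set E2}
    (hB : MeasurableSet B)
    (hd : ∀ y ∈ B, DifferentiableAt ℝ (fun y => (H y : E3)) y)
    (hi : InjOn H B) :
    (volume : Measure E3).toSphere (H '' B) =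
      ∫⁻ y in B, ENNReal.ofReal √(gramDet (fun y => (H y : E3)) y) := by
  set G : E2 → E3 := fun y => H y with hG
  have hn : ∀ y, ‖G y‖ = 1 := fun y => mem_sphere_zero_iff_norm.1 (H y).2
  have hc : ContinuousOn H B := by
    rw [Topology.IsInducing.subtypeVal.continuousOn_iff]
    exact fun y hy => (hd y hy).continuousAt.continuousWithinAt
  have hm : MeasurableSet (H '' B) := hB.image_of_continuousOn_injOn hc hi
  set S : Set E3 := splitFirst ⁻¹' (Ioo (0 : ℝ) 1 ×ˢ B) with hS
  set K : E3 → E3 := fun z => z 0 • G (dropFirst z) with hK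
  have hSm : MeasurableSet S := splitFirst.measurable (measurableSet_Ioo.prod hB)
  have hmem : ∀ z, z ∈ S ↔ z 0 ∈ Ioo (0 : ℝ) 1 ∧ dropFirst z ∈ B := fun z => Iff.rfl
  have hcone : Ioo (0 : ℝ) 1 • ((↑) '' (H '' B) : Set E3) = K '' S := by
    ext w
    constructor
    · rintro ⟨r, hr, _, ⟨_, ⟨y, hy, rfl⟩, rfl⟩, rfl⟩
      refine ⟨splitFirst.symm (r, y), ?_, ?_⟩
      · simp only [hS, mem_preimage, MeasurableEquiv.apply_symm_apply]
        exact ⟨hr, hy⟩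
      · have h1 := splitFirst.apply_symm_apply (r, y)
        rw [splitFirst_apply, Prod.mk.injEq] at h1
        simp only [hK, h1, hG]
    · rintro ⟨z, hz, rfl⟩
      exact ⟨z 0, hz.1, _, ⟨_, ⟨_, hz.2, rfl⟩, rfl⟩, rfl⟩
  have hinj : InjOn K S := by
    intro z hz z' hz' h
    have h1 := congrArg norm h
    simp only [hK, norm_smul, hn, mul_one, Real.norm_eq_abs, abs_of_pos ((hmem z).1 hz).1.1,
      abs_of_pos ((hmem z').1 hz').1.1] at h1
    have h2 : G (dropFirst z) = G (dropFirst z') := by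
      simp only [hK, h1] at h
      exact smul_right_injective _ ((hmem z').1 hz').1.1.ne' h
    have h3 := hi hz.2 hz'.2 (Subtype.ext h2)
    exact splitFirst.injective (by rw [splitFirst_apply, splitFirst_apply]; exact Prod.ext h1 h3)
  have hF : Measurable fun p : ℝ × E2 =>
      ENNReal.ofReal (p.1 ^ 2) * ENNReal.ofReal √(gramDet G p.2) := by
    have := measurable_gramDet G
    fun_prop
  have h3 : ∫⁻ r in Ioo (0 : ℝ) 1, ENNReal.ofReal (r ^ 2) = ENNReal.ofReal (1 / 3) := by
    rw [restrict_Ioo_eq_restrict_Ioc, ← ofReal_integral_eq_lintegral_ofReal,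
      ← intervalIntegral.integral_of_le zero_le_one]
    · norm_num
    · exact (intervalIntegrable_iff_integrableOn_Ioc_of_le zero_le_one).1
        ((continuous_pow 2).intervalIntegrable _ _)
    · exact Filter.Eventually.of_forall fun r => sq_nonneg r
  rw [Measure.toSphere_apply' _ hm, hcone, ← lintegral_abs_det_fderiv_eq_addHaar_image volume hSm
    (fun z hz => (hasFDerivAt_cone (hd _ hz.2)).hasFDerivWithinAt) hinj]
  have h4 : ∫⁻ z in S, ENNReal.ofReal |(coneDeriv G z).det| =
      ∫⁻ z in S, (fun p : ℝ × E2 =>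
        ENNReal.ofReal (p.1 ^ 2) * ENNReal.ofReal √(gramDet G p.2)) (splitFirst z) := by
    refine setLIntegral_congr_fun hSm fun z hz => ?_
    simp only [splitFirst_apply]
    rw [abs_det_coneDeriv hn (hd _ hz.2), ENNReal.ofReal_mul (sq_nonneg _)]
  rw [h4, measurePreserving_splitFirst.setLIntegral_comp_preimage (measurableSet_Ioo.prod hB) hF,
    Measure.volume_eq_prod, ← Measure.prod_restrict, lintegral_prod_mul
      (f := fun r : ℝ => ENNReal.ofReal (r ^ 2)) (g := fun y => ENNReal.ofReal √(gramDet G y))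
      (by fun_prop) ((measurable_gramDet G).sqrt.ennreal_ofReal.aemeasurable), h3, ← mul_assoc]
  have h5 : (Module.finrank ℝ E3 : ℝ≥0∞) * ENNReal.ofReal (1 / 3) = 1 := by
    rw [finrank_euclideanSpace_fin, ← ENNReal.ofReal_natCast, ← ENNReal.ofReal_mul (by positivity)]
    norm_num
  rw [h5, one_mul]

theorem toSphere_univ :
    (volume : Measure E3).toSphere univ = ENNReal.ofReal (4 * Real.pi) := by
  rw [Measure.toSphere_apply_univ, EuclideanSpace.volume_ball_fin_three, finrank_euclideanSpace_fin,
    ← ENNReal.ofReal_natCast, ← ENNReal.ofReal_pow zero_le_one,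
    ← ENNReal.ofReal_mul (by positivity), ← ENNReal.ofReal_mul (by positivity)]
  congr 1
  push_cast
  ring

/-- The action of a linear isometry on the unit sphere. -/
def sphereMap (R : E3 ≃ₗᵢ[ℝ] E3) (x : S2) : S2 :=
  ⟨R x, mem_sphere_zero_iff_norm.2 (by rw [R.norm_map]; exact mem_sphere_zero_iff_norm.1 x.2)⟩

theorem continuous_sphereMap (R : E3 ≃ₗᵢ[ℝ] E3) :
    Continuous (sphereMap R) :=
  (R.continuous.comp continuous_subtype_val).subtype_mk _

/-- A linear isometry preserves Lebesgue measure and carries cones over spherical sets to cones over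
their images. -/
theorem measurePreserving_sphereMap
    (R : E3 ≃ₗᵢ[ℝ] E3) :
    MeasurePreserving (sphereMap R) (volume : Measure E3).toSphere
      (volume : Measure E3).toSphere := by
  have hm := (continuous_sphereMap R).measurable
  refine ⟨hm, Measure.ext fun s hs => ?_⟩
  rw [Measure.map_apply hm hs, Measure.toSphere_apply' _ hs, Measure.toSphere_apply' _ (hm hs)]
  congr 1
  have : Ioo (0 : ℝ) 1 • ((↑) '' (sphereMap R ⁻¹' s) : Set E3) =
      R ⁻¹' (Ioo (0 : ℝ) 1 • ((↑) '' s)) := by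
    ext w
    constructor
    · rintro ⟨r, hr, _, ⟨x, hx, rfl⟩, rfl⟩
      exact ⟨r, hr, _, ⟨_, hx, rfl⟩, by simp [sphereMap]⟩
    · rintro ⟨r, hr, _, ⟨x, hx, rfl⟩, h⟩
      have hx' : sphereMap R (sphereMap R.symm x) = x := Subtype.ext (by simp [sphereMap])
      refine ⟨r, hr, _, ⟨sphereMap R.symm x, by rwa [mem_preimage, hx'], rfl⟩, R.injective ?_⟩
      simp only [sphereMap, map_smul, R.apply_symm_apply]
      exact h
  rw [this]
  exact (LinearIsometryEquiv.measurePreserving R).measure_preimage_equiv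
    (f := R.toHomeomorph.toMeasurableEquiv) _

/-! ### The double covering, its local sections, and local isometries -/

namespace RP2

/-- The double covering `φ ∘ proj` of the projective plane by the sphere. -/
def cover (φ : RP2 ≃ₘ^∞⟮𝓡 2, 𝓡 2⟯ RP2) (x : S2) : RP2 := φ (proj x)

variable (φ : RP2 ≃ₘ^∞⟮𝓡 2, 𝓡 2⟯ RP2)

theorem cover_eq_iff {x y : S2} : cover φ x = cover φ y ↔ x = y ∨ x = -y := by
  exact φ.injective.eq_iff.trans proj_eq_iff

theorem cover_neg (x : S2) : cover φ (-x) = cover φ x := (cover_eq_iff φ).2 (Or.inr rfl)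

theorem contMDiff_cover : ContMDiff (𝓡 2) (𝓡 2) 1 (cover φ) :=
  (φ.contMDiff_toFun.of_le (by norm_cast)).comp (contMDiff_proj.of_le (by exact le_top))

theorem continuous_cover : Continuous (cover φ) := (contMDiff_cover φ).continuous

theorem cover_surjective : Function.Surjective (cover φ) := φ.surjective.comp proj_surjective

instance : CompactSpace RP2 := proj_surjective.compactSpace contMDiff_proj.continuous

instance : SecondCountableTopology RP2 :=
  (isCoveringMap_proj.isQuotientMap proj_surjective).secondCountableTopology
    isCoveringMap_proj.isOpenMap

/-- A chart of the projective plane is a local inverse of `proj` followed by a chart of the sphere.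
Undoing the latter leaves the local inverse, here composed with `φ⁻¹`; factoring through charts
makes its smoothness evident. -/
theorem exists_localSection (p : RP2) : ∃ (W : Set RP2) (s : RP2 → S2), IsOpen W ∧ p ∈ W ∧
    ContMDiffOn (𝓡 2) (𝓡 2) 1 s W ∧ ∀ q ∈ W, cover φ (s q) = q := by
  have hle : (1 : ℕ∞ω) ≤ ω := le_top
  obtain ⟨L, x, hL, hc⟩ := exists_chart_eq (chart_mem_atlas E2 (φ.symm p))
  set e := chartAt E2 (φ.symm p)
  have hsm : ContMDiff (𝓡 2) (𝓡 2) 1 φ.symm := φ.symm.contMDiff_toFun.of_le (by norm_cast)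
  have he1 : ContMDiffOn (𝓡 2) (𝓡 2) 1 e e.source := contMDiffOn_chart.of_le le_rfl
  have he2 : ContMDiffOn (𝓡 2) (𝓡 2) 1 (chartAt E2 x).symm
    (chartAt E2 x).target := contMDiffOn_chart_symm
  have hval : ∀ q ∈ e.source, L q ∈ (chartAt E2 x).source ∧ q ∈ L.source ∧
      e q = chartAt E2 x (L q) := by
    intro q hq
    rw [hc] at hq ⊢
    simp only [OpenPartialHomeomorph.trans_source, mem_inter_iff, mem_preimage] at hq
    exact ⟨hq.2, hq.1, rfl⟩
  refine ⟨φ.symm ⁻¹' e.source, (chartAt E2 x).symm ∘ e ∘ φ.symm,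
    e.open_source.preimage hsm.continuous, mem_chart_source E2 (φ.symm p), ?_, ?_⟩
  · refine he2.comp (he1.comp hsm.contMDiffOn fun q hq => hq) fun q hq => ?_
    obtain ⟨h1, h2, h3⟩ := hval _ hq
    rw [mem_preimage, Function.comp_apply, h3]
    exact (chartAt E2 x).map_source h1
  · intro q hq
    obtain ⟨h1, h2, h3⟩ := hval _ hq
    rw [Function.comp_apply, Function.comp_apply, h3,
      (chartAt E2 x).left_inv h1, cover, ← hL, L.left_inv h2]
    exact φ.apply_symm_apply q

end RP2

/-- `φ` realizes `g₀` as a round metric: `cover φ` is a local isometry. -/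
def IsRoundVia (g₀ : SurfaceMetric RP2) (φ : RP2 ≃ₘ^∞⟮𝓡 2, 𝓡 2⟯ RP2) : Prop :=
  ∀ (x : S2) (v w : TangentSpace (𝓡 2) x),
    g₀.inner (cover φ x) (mfderiv (𝓡 2) (𝓡 2) (cover φ) x v) (mfderiv (𝓡 2) (𝓡 2) (cover φ) x w) =
    inner ℝ
      (mvfderiv (𝓡 2) (fun y : S2 => (y : E3)) x v)
      (mvfderiv (𝓡 2) (fun y : S2 => (y : E3)) x w)

namespace IsRoundVia

variable {g₀ : SurfaceMetric RP2} {φ : RP2 ≃ₘ^∞⟮𝓡 2, 𝓡 2⟯ RP2}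

theorem mdifferentiableAt_coe (x : S2) :
    MDifferentiableAt (𝓡 2) 𝓘(ℝ, E3) (fun y : S2 => (y : E3)) x :=
  ((contMDiff_coe_sphere (n := 2) (m := 1) (E := E3)).mdifferentiable one_ne_zero) x

theorem differentiableAt_coe_comp {E : Type*} [NormedAddCommGroup E] [NormedSpace ℝ E]
    {h : E → S2} {y : E} (hh : MDifferentiableAt 𝓘(ℝ, E) (𝓡 2) h y) :
    DifferentiableAt ℝ (fun z => (h z : E3)) y ∧
    ∀ v : E, mvfderiv (𝓡 2) (fun y : S2 => (y : E3)) (h y)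
      (mfderiv 𝓘(ℝ, E) (𝓡 2) h y v) = fderiv ℝ (fun z => (h z : E3)) y v := by
  have h1 := (mdifferentiableAt_coe (h y)).comp y hh
  refine ⟨h1.differentiableAt, fun v => ?_⟩
  have h2 := mfderiv_comp y (mdifferentiableAt_coe (h y)) hh
  rw [mfderiv_eq_fderiv] at h2
  exact (DFunLike.congr_fun h2 v).symm

/-- Chain rule through a lift: scalar products for the round metric become Euclidean ones of the
lifted map. It serves both area densities and speeds of curves. -/
theorem inner_mfderiv (hg : IsRoundVia g₀ φ) {E : Type*} [NormedAddCommGroup E] [NormedSpace ℝ E]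
    {h : E → S2} {Ψ : E → RP2} {y : E} (hh : MDifferentiableAt 𝓘(ℝ, E) (𝓡 2) h y)
    (hΨ : Ψ =ᶠ[𝓝 y] cover φ ∘ h) (v w : E) :
    g₀.inner (Ψ y) (mfderiv 𝓘(ℝ, E) (𝓡 2) Ψ y v) (mfderiv 𝓘(ℝ, E) (𝓡 2) Ψ y w) =
      inner ℝ (fderiv ℝ (fun z => (h z : E3)) y v)
        (fderiv ℝ (fun z => (h z : E3)) y w) := by
  have h1 : MDifferentiableAt (𝓡 2) (𝓡 2) (cover φ) (h y) :=
    ((contMDiff_cover φ).mdifferentiable one_ne_zero) (h y)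
  rw [hΨ.mfderiv_eq, mfderiv_comp y h1 hh, hΨ.eq_of_nhds,
    ← (differentiableAt_coe_comp hh).2, ← (differentiableAt_coe_comp hh).2]
  exact hg _ _ _

end IsRoundVia

/-! ### Identification of the round area measure -/

/-- Countable local comparison of measures. -/
theorem measure_le_of_forall_nhds {X : Type*} [TopologicalSpace X] [SecondCountableTopology X]
    [MeasurableSpace X] [BorelSpace X] {μ ν : Measure X} {s : Set X} (hs : ν sᶜ = 0)
    (h : ∀ p ∈ s, ∃ V : Set X, IsOpen V ∧ p ∈ V ∧ ν.restrict V ≤ μ) : ν ≤ μ := by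
  choose! V hV hp hle using h
  obtain ⟨t, hts, htc, hcov⟩ := TopologicalSpace.countable_cover_nhdsWithin (f := V) (s := s)
    fun x hx => mem_nhdsWithin_of_mem_nhds ((hV x hx).mem_nhds (hp x hx))
  have hν : ν = ν.restrict (⋃ x ∈ t, V x) := by
    refine (Measure.restrict_eq_self_of_ae_mem ?_).symm
    rw [ae_iff]
    exact measure_mono_null (fun x hx hxs => hx (hcov hxs)) hs
  rcases t.eq_empty_or_nonempty with rfl | hne
  · rw [hν]; simp [Measure.zero_le]
  obtain ⟨u, rfl⟩ := htc.exists_eq_range hne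
  rw [biUnion_range] at hν
  have hVm : ∀ n, MeasurableSet (V (u n)) := fun n => (hV _ (hts ⟨n, rfl⟩)).measurableSet
  have hDm : ∀ n, MeasurableSet (disjointed (fun n => V (u n)) n) := fun n => .disjointed hVm n
  refine Measure.le_iff.2 fun A hA => ?_
  -- Making the countable cover disjoint lets the local inequalities be summed without counting
  -- overlaps twice.
  rw [hν, Measure.restrict_apply hA, ← iUnion_disjointed, inter_iUnion,
    measure_iUnion
      (fun i j hij => ((disjoint_disjointed _) hij).mono inter_subset_right inter_subset_right)
      fun n => hA.inter (hDm n)]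
  calc ∑' n, ν (A ∩ disjointed (fun n => V (u n)) n)
      ≤ ∑' n, μ (A ∩ disjointed (fun n => V (u n)) n) := by
        refine ENNReal.tsum_le_tsum fun n => ?_
        have := hle (u n) (hts ⟨n, rfl⟩) (A ∩ disjointed (fun n => V (u n)) n)
        rwa [Measure.restrict_apply (hA.inter (hDm n)), inter_eq_self_of_subset_left
          (inter_subset_right.trans (disjointed_subset _ n))] at this
    _ = μ (⋃ n, A ∩ disjointed (fun n => V (u n)) n) := (measure_iUnion
          (fun i j hij => ((disjoint_disjointed _) hij).mono inter_subset_right inter_subset_right)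
          fun n => hA.inter (hDm n)).symm
    _ ≤ μ A := measure_mono (iUnion_subset fun n => inter_subset_left)

/-- The area measure of the unit sphere. -/
def sphereArea : Measure S2 := (volume : Measure E3).toSphere

theorem sphereArea_neg (B : Set S2) : sphereArea ((fun x => -x) ⁻¹' B) = sphereArea B := by
  have h := measurePreserving_sphereMap (LinearIsometryEquiv.neg ℝ)
  have h1 : sphereMap (LinearIsometryEquiv.neg ℝ) = fun x => -x := by
    ext x : 2; simp [sphereMap]
  rw [h1] at h
  exact h.measure_preimage_equiv (f := (Homeomorph.neg S2).toMeasurableEquiv) B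

/-- The image of half the area measure of the sphere under the double covering. -/
def coverArea (φ : RP2 ≃ₘ^∞⟮𝓡 2, 𝓡 2⟯ RP2) : Measure RP2 :=
  (2 : ℝ≥0∞)⁻¹ • sphereArea.map (cover φ)

theorem coverArea_univ (φ : RP2 ≃ₘ^∞⟮𝓡 2, 𝓡 2⟯ RP2) :
    coverArea φ univ = ENNReal.ofReal (2 * Real.pi) := by
  rw [coverArea, Measure.smul_apply, Measure.map_apply (continuous_cover φ).measurable .univ,
    preimage_univ, sphereArea, toSphere_univ, smul_eq_mul, ← ENNReal.ofReal_ofNat 2,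
    ← ENNReal.ofReal_inv_of_pos two_pos, ← ENNReal.ofReal_mul (by positivity)]
  congr 1
  ring

namespace IsRoundVia

variable {g₀ : SurfaceMetric RP2} {φ : RP2 ≃ₘ^∞⟮𝓡 2, 𝓡 2⟯ RP2}

/-- Near p the inverse chart lifts to a parametrization h of a patch of the sphere, whose Gram
determinant is the determinant of the metric coefficients. `toSphere_image` then computes the area
of the patch. -/
theorem exists_restrict_chartArea_eq (hg : IsRoundVia g₀ φ)
    {e : OpenPartialHomeomorph RP2 E2}
    (he : e ∈ atlas E2 RP2) {p : RP2} (hp : p ∈ e.source) :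
    ∃ V : Set RP2, IsOpen V ∧ p ∈ V ∧
      (g₀.chartArea e).restrict V = (coverArea φ).restrict V := by
  obtain ⟨W, s, hW, hpW, hs, hQ⟩ := exists_localSection φ p
  have he1 : ContMDiffOn (𝓡 2) (𝓡 2) 1 e.symm e.target :=
    contMDiffOn_symm_of_mem_maximalAtlas (IsManifold.subset_maximalAtlas he)
  set V := e.source ∩ W with hV
  have hVo : IsOpen V := e.open_source.inter hW
  set U := e.target ∩ e.symm ⁻¹' W with hU
  have hUo : IsOpen U := e.isOpen_inter_preimage_symm hW
  set h : E2 → S2 := s ∘ e.symm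
  have hsm : ContMDiffOn (𝓡 2) (𝓡 2) 1 h U := hs.comp (he1.mono inter_subset_left) fun y hy => hy.2
  have hmd : ∀ y ∈ U, MDifferentiableAt (𝓡 2) (𝓡 2) h y := fun y hy =>
    (hsm.contMDiffAt (hUo.mem_nhds hy)).mdifferentiableAt one_ne_zero
  have hlift : ∀ y ∈ U, cover φ (h y) = e.symm y := fun y hy => hQ _ hy.2
  have hinj : InjOn h U := fun y hy y' hy' hyy => by
    have := congrArg (cover φ) hyy
    rw [hlift y hy, hlift y' hy'] at this
    exact e.symm.injOn hy.1 hy'.1 this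
  have hcoeff : ∀ y ∈ U, (Matrix.of (g₀.coeff e y)).det =
      gramDet (fun z => (h z : E3)) y := by
    intro y hy
    unfold gramDet
    congr 1
    ext i j
    refine hg.inner_mfderiv (hmd y hy) ?_ _ _
    filter_upwards [hUo.mem_nhds hy] with z hz
    exact (hlift z hz).symm
  refine ⟨V, hVo, ⟨hp, hpW⟩, Measure.ext fun A hA => ?_⟩
  have heae : AEMeasurable e.symm ((volume.restrict e.target).withDensity
      fun y => ENNReal.ofReal √(Matrix.of (g₀.coeff e y)).det) :=
    (e.continuousOn_symm.aemeasurable e.open_target.measurableSet).mono_ac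
      (withDensity_absolutelyContinuous _ _)
  have hAV : MeasurableSet (A ∩ V) := hA.inter hVo.measurableSet
  have hBset : e.symm ⁻¹' (A ∩ V) ∩ e.target = U ∩ e.symm ⁻¹' A := by
    ext y
    simp only [hV, hU, mem_inter_iff, mem_preimage]
    constructor
    · rintro ⟨⟨h1, h2, h3⟩, h4⟩; exact ⟨⟨h4, h3⟩, h1⟩
    · rintro ⟨⟨h4, h3⟩, h1⟩; exact ⟨⟨h1, e.map_target h4, h3⟩, h4⟩
  set B := U ∩ e.symm ⁻¹' A with hB
  have hBm : MeasurableSet B := by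
    have hc : ContinuousOn e.symm U := e.continuousOn_symm.mono inter_subset_left
    have := hUo.measurableSet.subtype_image
      ((continuousOn_iff_continuous_domRestrict.1 hc).measurable hA)
    rwa [domRestrict_eq, preimage_comp, Subtype.image_preimage_coe] at this
  -- The two sheets over `A ∩ V`: disjoint antipodal patches of equal area, which accounts for the
  -- factor 1/2 in `coverArea`.
  have hpre : cover φ ⁻¹' (A ∩ V) = h '' B ∪ (fun x => -x) ⁻¹' (h '' B) := by
    ext x
    constructor
    · intro hx
      have hx1 : e (cover φ x) ∈ B := by
        rw [← hBset]
        refine ⟨?_, e.map_source hx.2.1⟩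
        rw [mem_preimage, e.left_inv hx.2.1]
        exact hx
      have hx2 : cover φ (h (e (cover φ x))) = cover φ x := by
        rw [hlift _ hx1.1, e.left_inv hx.2.1]
      rcases (cover_eq_iff φ).1 hx2 with h3 | h3
      · exact Or.inl ⟨_, hx1, h3⟩
      · exact Or.inr ⟨_, hx1, h3⟩
    · have key : ∀ y ∈ B, cover φ (h y) ∈ A ∩ V := by
        intro y hy
        rw [hlift y hy.1]
        exact (hBset.symm.subset hy).1
      rintro (⟨y, hy, rfl⟩ | ⟨y, hy, hyx⟩)
      · exact key y hy
      · change h y = -x at hyx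
        rw [mem_preimage, ← cover_neg, ← hyx]
        exact key y hy
  have hdisj : Disjoint (h '' B) ((fun x => -x) ⁻¹' (h '' B)) := by
    rw [Set.disjoint_left]
    rintro _ ⟨y, hy, rfl⟩ ⟨y', hy', h1⟩
    have h2 := congrArg (cover φ) h1
    simp only [cover_neg] at h2
    rw [hlift y hy.1, hlift y' hy'.1] at h2
    have h3 := e.symm.injOn hy'.1.1 hy.1.1 h2
    rw [h3] at h1
    exact ne_neg_of_mem_unit_sphere ℝ _ h1
  have hcont : ContinuousOn h B := hsm.continuousOn.mono inter_subset_left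
  have him : MeasurableSet (h '' B) :=
    hBm.image_of_continuousOn_injOn hcont (hinj.mono inter_subset_left)
  rw [Measure.restrict_apply hA, Measure.restrict_apply hA, coverArea, Measure.smul_apply,
    Measure.map_apply (continuous_cover φ).measurable hAV, hpre,
    measure_union hdisj (him.preimage continuous_neg.measurable), sphereArea_neg, smul_eq_mul,
    ← two_mul, ← mul_assoc, ENNReal.inv_mul_cancel two_ne_zero ENNReal.ofNat_ne_top, one_mul,
    sphereArea, toSphere_image hBm (fun y hy => (differentiableAt_coe_comp (hmd y hy.1)).1)
      (hinj.mono inter_subset_left), SurfaceMetric.chartArea,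
    Measure.map_apply_of_aemeasurable heae hAV, withDensity_apply', Measure.restrict_restrict',
    hBset]
  · exact setLIntegral_congr_fun hBm fun y hy => by simp only [hcoeff y hy.1]
  · exact e.open_target.measurableSet

/-- Each chart measure agrees with `coverArea φ` locally on its domain, so it is bounded by it;
conversely, around every point `coverArea φ` agrees with some chart measure, so it is bounded by
their supremum. -/
theorem area_eq (hg : IsRoundVia g₀ φ) : g₀.area = coverArea φ := by
  apply le_antisymm
  · refine iSup₂_le fun e he => measure_le_of_forall_nhds (s := e.source) ?_ fun p hp => ?_
    · rw [SurfaceMetric.chartArea, Measure.map_apply_of_aemeasurable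
        ((e.continuousOn_symm.aemeasurable e.open_target.measurableSet).mono_ac
          (withDensity_absolutelyContinuous _ _)) e.open_source.measurableSet.compl]
      refine withDensity_absolutelyContinuous _ _ ?_
      rw [Measure.restrict_apply' e.open_target.measurableSet]
      convert measure_empty (μ := volume)
      ext y
      simp only [mem_inter_iff, mem_preimage, mem_compl_iff, mem_empty_iff_false,
        iff_false, not_and]
      exact fun h1 h2 => h1 (e.map_target h2)
    · obtain ⟨V, hV, hpV, h⟩ := hg.exists_restrict_chartArea_eq he hp
      exact ⟨V, hV, hpV, h ▸ Measure.restrict_le_self⟩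
  · refine measure_le_of_forall_nhds (s := univ) (by simp) fun p _ => ?_
    obtain ⟨V, hV, hpV, h⟩ := hg.exists_restrict_chartArea_eq
      (chart_mem_atlas E2 p) (mem_chart_source _ p)
    refine ⟨V, hV, hpV, h ▸ Measure.restrict_le_self.trans ?_⟩
    exact le_iSup₂ (f := fun e (_ : e ∈ atlas E2 RP2) => g₀.chartArea e) _
      (chart_mem_atlas _ p)

end IsRoundVia

/-! ### Averaging over the orthogonal group -/

/-- The orthogonal group of Euclidean `3`-space. -/
abbrev O3 : Type := unitary (E3 →L[ℝ] E3)

namespace O3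

instance : ContinuousStar (E3 →L[ℝ] E3) :=
  ⟨ContinuousLinearMap.adjoint.continuous⟩

instance : CompactSpace O3 := by
  have : ProperSpace (E3 →L[ℝ] E3) :=
    FiniteDimensional.proper ℝ _
  refine (isCompact_iff_compactSpace (X := E3 →L[ℝ] E3)
    (s := (unitary (E3 →L[ℝ] E3) : Set _))).1 ?_
  refine Metric.isCompact_of_isClosed_isBounded isClosed_unitary ?_
  refine (Metric.isBounded_closedBall (x := 0) (r := 1)).subset fun u hu => ?_
  rw [mem_closedBall_zero_iff]
  exact (CStarRing.norm_of_mem_unitary hu).le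

instance : SecondCountableTopology O3 := by
  have : ProperSpace (E3 →L[ℝ] E3) :=
    FiniteDimensional.proper ℝ _
  infer_instance

/-- The linear isometry given by an element of the orthogonal group. -/
def toIsometry (k : O3) : E3 ≃ₗᵢ[ℝ] E3 :=
  Unitary.linearIsometryEquiv k

/-- The action of the orthogonal group on the sphere. -/
def act (k : O3) (x : S2) : S2 := sphereMap k.toIsometry x

theorem continuous_act : Continuous fun p : O3 × S2 => act p.1 p.2 := by
  refine Continuous.subtype_mk (f := fun p : O3 × S2 =>
    (p.1 : E3 →L[ℝ] E3) (p.2 : E3)) ?_ _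
  fun_prop

theorem exists_act_eq (x y : S2) : ∃ k : O3, act k x = y := by
  -- The reflection in the plane orthogonal to x - y exchanges two vectors of equal norm.
  refine ⟨Unitary.linearIsometryEquiv.symm (ℝ ∙ ((x : E3) - y))ᗮ.reflection, Subtype.ext ?_⟩
  simp only [act, toIsometry, MulEquiv.apply_symm_apply, sphereMap]
  exact Submodule.reflection_sub (by
    rw [mem_sphere_zero_iff_norm.1 x.2, mem_sphere_zero_iff_norm.1 y.2])

instance : MeasurableSpace O3 := borel O3
instance : BorelSpace O3 := ⟨rfl⟩

/-- The right-invariant probability measure on the orthogonal group. -/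
def haarProb : Measure O3 := (Measure.haarMeasure (⊤ : TopologicalSpace.PositiveCompacts O3)).inv

instance : IsProbabilityMeasure haarProb := ⟨by
  rw [haarProb, Measure.inv_apply, inv_univ, ← TopologicalSpace.PositiveCompacts.coe_top]
  exact Measure.haarMeasure_self⟩

instance : haarProb.IsMulRightInvariant := by unfold haarProb; infer_instance

/-- The action is transitive, and replacing x by `act l x` amounts to translating k on the right by
l; hence the choice of a right-invariant measure. -/
theorem lintegral_act_eq (F : S2 → ℝ≥0∞) (x y : S2) :
    ∫⁻ k, F (act k x) ∂haarProb = ∫⁻ k, F (act k y) ∂haarProb := by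
  obtain ⟨l, rfl⟩ := exists_act_eq x y
  rw [← lintegral_mul_right_eq_self (fun k => F (act k x)) l]
  rfl

instance : IsFiniteMeasure sphereArea := by unfold sphereArea; infer_instance

/-- Average the integral over all isometries, each preserving the spherical measure, and exchange
the integrals: the inner average no longer depends on the point. -/
theorem lintegral_sphereArea {F : S2 → ℝ≥0∞} (hF : Measurable F) (x : S2) :
    ∫⁻ y, F y ∂sphereArea = sphereArea univ * ∫⁻ k, F (act k x) ∂haarProb := by
  have hm : Measurable fun p : O3 × S2 => F (act p.1 p.2) := hF.comp continuous_act.measurable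
  calc ∫⁻ y, F y ∂sphereArea = ∫⁻ _ : O3, ∫⁻ y, F y ∂sphereArea ∂haarProb := by simp
    _ = ∫⁻ k : O3, ∫⁻ y, F (act k y) ∂sphereArea ∂haarProb :=
        lintegral_congr fun k => ((measurePreserving_sphereMap k.toIsometry).lintegral_comp hF).symm
    _ = ∫⁻ y, ∫⁻ k, F (act k y) ∂haarProb ∂sphereArea :=
        lintegral_lintegral_swap hm.aemeasurable
    _ = ∫⁻ _, ∫⁻ k, F (act k x) ∂haarProb ∂sphereArea :=
        lintegral_congr fun y => lintegral_act_eq F y x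
    _ = sphereArea univ * ∫⁻ k, F (act k x) ∂haarProb := by rw [lintegral_const, mul_comm]

end O3

/-- Averaging over all images of a curve under isometries of the sphere. -/
theorem mul_le_lintegral_sphereArea {F : S2 → ℝ≥0∞} (hF : Measurable F) {c : ℝ → S2}
    (hc : Continuous c) {l : ℝ≥0∞}
    (h : ∀ R : E3 ≃ₗᵢ[ℝ] E3,
      l ≤ ∫⁻ t in Ioo (0 : ℝ) 1, F (sphereMap R (c t))) :
    sphereArea univ * l ≤ ∫⁻ x, F x ∂sphereArea := by
  have hm : Measurable fun p : O3 × ℝ => F (O3.act p.1 (c p.2)) :=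
    hF.comp (O3.continuous_act.comp
      (by fun_prop : Continuous fun p : O3 × ℝ => (p.1, c p.2))).measurable
  calc sphereArea univ * l = sphereArea univ * ∫⁻ _ : O3, l ∂O3.haarProb := by simp
    _ ≤ sphereArea univ * ∫⁻ k : O3, (∫⁻ t in Ioo (0 : ℝ) 1, F (O3.act k (c t))) ∂O3.haarProb := by
        gcongr with k
        exact h k.toIsometry
    _ = sphereArea univ * ∫⁻ t in Ioo (0 : ℝ) 1, ∫⁻ k : O3, F (O3.act k (c t)) ∂O3.haarProb := by
        rw [lintegral_lintegral_swap hm.aemeasurable]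
    _ = ∫⁻ t in Ioo (0 : ℝ) 1, ∫⁻ x, F x ∂sphereArea := by
        rw [← lintegral_const_mul _ hm.lintegral_prod_left']
        exact lintegral_congr fun t => (O3.lintegral_sphereArea hF (c t)).symm
    _ = ∫⁻ x, F x ∂sphereArea := by simp

/-! ### Great semicircles as noncontractible loops -/

theorem SurfaceMetric.speed_of_conformal {M : Type*} [TopologicalSpace M]
    [ChartedSpace E2 M] [IsManifold (𝓡 2) 1 M] {g₀ g : SurfaceMetric M}
    {f : M → ℝ} (hf : ∀ x, 0 < f x)
    (hg : ∀ (x : M) (v w : TangentSpace (𝓡 2) x), g.inner x v w = f x ^ 2 * g₀.inner x v w)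
    (γ : ℝ → M) (t : ℝ) : g.speed γ t = f (γ t) * g₀.speed γ t := by
  rw [speed, hg, Real.sqrt_mul (sq_nonneg _), Real.sqrt_sq (hf _).le, speed]

theorem IsRoundVia.speed_eq {g₀ : SurfaceMetric RP2} {φ : RP2 ≃ₘ^∞⟮𝓡 2, 𝓡 2⟯ RP2}
    (hg : IsRoundVia g₀ φ) {γ : ℝ → RP2} {h : ℝ → S2} {t : ℝ}
    (hh : MDifferentiableAt 𝓘(ℝ, ℝ) (𝓡 2) h t) (hγ : γ =ᶠ[𝓝 t] cover φ ∘ h) :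
    g₀.speed γ t = ‖deriv (fun s => (h s : E3)) t‖ := by
  rw [SurfaceMetric.speed, hg.inner_mfderiv hh hγ, fderiv_apply_one_eq_deriv,
    real_inner_self_eq_norm_sq, Real.sqrt_sq (norm_nonneg _)]

theorem isCoveringMap_cover (φ : RP2 ≃ₘ^∞⟮𝓡 2, 𝓡 2⟯ RP2) : IsCoveringMap (cover φ) :=
  isCoveringMap_proj.homeomorph_comp φ.toHomeomorph

/-- A null-homotopic loop lifts to a loop. -/
theorem lift_closed_of_homotopic {φ : RP2 ≃ₘ^∞⟮𝓡 2, 𝓡 2⟯ RP2} {p : RP2} {γ : Path p p}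
    {Γ : C(unitInterval, S2)} (hΓ : ∀ t, cover φ (Γ t) = γ t) (h : γ.Homotopic (Path.refl p)) :
    Γ 0 = Γ 1 := by
  obtain ⟨F⟩ := h
  have h0 : cover φ (Γ 0) = p := (hΓ 0).trans γ.source
  -- The lift of the null homotopy is again relative to the endpoints, and it connects `Γ` with a
  -- constant path; so the endpoint of `Γ` is `Γ 0`.
  have := (isCoveringMap_cover φ).liftHomotopyRel F (f₀' := Γ) (f₁' := .const _ (Γ 0))
    ⟨0, by simp, rfl⟩
    (funext hΓ) (funext fun _ => h0)
  exact (this.eq_fst 0 (x := 1) (by simp) ▸ this.eq_snd 0 (x := 1) (by simp)).symm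

/-- The great semicircle `t ↦ (cos πt, sin πt, 0)`, `0 ≤ t ≤ 1`, extended to a great circle. -/
def greatCircle (t : ℝ) : S2 :=
  ⟨!₂[Real.cos (Real.pi * t), Real.sin (Real.pi * t), 0], by
    rw [mem_sphere_zero_iff_norm, EuclideanSpace.norm_eq, Real.sqrt_eq_one]
    simp [Fin.sum_univ_three]⟩

theorem hasDerivAt_greatCircle (t : ℝ) :
    HasDerivAt (fun t => (greatCircle t : E3))
      !₂[-(Real.pi * Real.sin (Real.pi * t)), Real.pi * Real.cos (Real.pi * t), 0] t := by
  have h1 : HasDerivAt (fun t => Real.pi * t) Real.pi t := by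
    simpa using (hasDerivAt_id t).const_mul Real.pi
  refine (PiLp.continuousLinearEquiv 2 ℝ fun _ : Fin 3 => ℝ).symm.hasFDerivAt.comp_hasDerivAt t
    (hasDerivAt_pi.2 fun i => ?_)
  fin_cases i
  · exact h1.cos.congr_deriv (by change _ = -(Real.pi * Real.sin (Real.pi * t)); ring)
  · exact h1.sin.congr_deriv (mul_comm _ _)
  · exact hasDerivAt_const t (0 : ℝ)

theorem contDiff_greatCircle : ContDiff ℝ 1 (fun t => (greatCircle t : E3)) := by
  rw [contDiff_euclidean]
  intro i
  fin_cases i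
  · exact Real.contDiff_cos.comp (contDiff_const.mul contDiff_id)
  · exact Real.contDiff_sin.comp (contDiff_const.mul contDiff_id)
  · exact contDiff_const

theorem continuous_greatCircle : Continuous greatCircle :=
  continuous_induced_rng.2 contDiff_greatCircle.continuous

theorem contMDiff_sphereMap_greatCircle (R : E3 ≃ₗᵢ[ℝ] E3) :
    ContMDiff 𝓘(ℝ, ℝ) (𝓡 2) 1 fun t => sphereMap R (greatCircle t) :=
  ContMDiff.codRestrict_sphere (f := fun t => R (greatCircle t : E3))
    (R.contDiff.comp contDiff_greatCircle).contMDiff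
    fun t => (sphereMap R (greatCircle t)).2

theorem norm_deriv_sphereMap_greatCircle
    (R : E3 ≃ₗᵢ[ℝ] E3) (t : ℝ) :
    ‖deriv (fun t => (sphereMap R (greatCircle t) : E3)) t‖ = Real.pi := by
  have h : HasDerivAt (fun t => (sphereMap R (greatCircle t) : E3))
      (R !₂[-(Real.pi * Real.sin (Real.pi * t)), Real.pi * Real.cos (Real.pi * t), 0]) t :=
    R.toContinuousLinearEquiv.hasFDerivAt.comp_hasDerivAt t (hasDerivAt_greatCircle t)
  rw [h.deriv, R.norm_map, EuclideanSpace.norm_eq, Real.sqrt_eq_iff_mul_self_eq_of_pos Real.pi_pos]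
  simp [Fin.sum_univ_three]
  nlinarith [Real.sin_sq_add_cos_sq (Real.pi * t)]

theorem greatCircle_one : greatCircle 1 = -greatCircle 0 := by
  refine Subtype.ext ?_
  ext i
  fin_cases i <;> simp [greatCircle]

theorem sphereMap_neg (R : E3 ≃ₗᵢ[ℝ] E3) (x : S2) :
    sphereMap R (-x) = -sphereMap R x := Subtype.ext (by simp [sphereMap])

/-- The loop in the projective plane covered by a great semicircle. -/
def greatLoop (φ : RP2 ≃ₘ^∞⟮𝓡 2, 𝓡 2⟯ RP2)
    (R : E3 ≃ₗᵢ[ℝ] E3) :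
    Path (cover φ (sphereMap R (greatCircle 0))) (cover φ (sphereMap R (greatCircle 0))) where
  toFun t := cover φ (sphereMap R (greatCircle t))
  continuous_toFun := (continuous_cover φ).comp ((continuous_sphereMap R).comp
    (continuous_greatCircle.comp continuous_subtype_val))
  source' := rfl
  target' := by
    rw [Set.Icc.coe_one, greatCircle_one, sphereMap_neg, cover_neg]

theorem greatLoop_extend (φ : RP2 ≃ₘ^∞⟮𝓡 2, 𝓡 2⟯ RP2)
    (R : E3 ≃ₗᵢ[ℝ] E3) {t : ℝ} (ht : t ∈ Icc (0 : ℝ) 1) :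
    (greatLoop φ R).extend t = cover φ (sphereMap R (greatCircle t)) := by
  rw [Path.extend_apply _ ht]
  rfl

theorem contMDiffOn_greatLoop (φ : RP2 ≃ₘ^∞⟮𝓡 2, 𝓡 2⟯ RP2)
    (R : E3 ≃ₗᵢ[ℝ] E3) :
    ContMDiffOn 𝓘(ℝ, ℝ) (𝓡 2) 1 (greatLoop φ R).extend (Icc 0 1) :=
  ((contMDiff_cover φ).comp (contMDiff_sphereMap_greatCircle R)).contMDiffOn.congr
    fun _ ht => greatLoop_extend φ R ht

theorem not_homotopic_greatLoop (φ : RP2 ≃ₘ^∞⟮𝓡 2, 𝓡 2⟯ RP2)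
    (R : E3 ≃ₗᵢ[ℝ] E3) :
    ¬ (greatLoop φ R).Homotopic (Path.refl _) := by
  intro h
  have := lift_closed_of_homotopic (φ := φ) (Γ := ⟨fun t => sphereMap R (greatCircle t),
    (continuous_sphereMap R).comp (continuous_greatCircle.comp continuous_subtype_val)⟩)
    (fun t => rfl) h
  simp only [ContinuousMap.coe_mk, Set.Icc.coe_zero, Set.Icc.coe_one, greatCircle_one,
    sphereMap_neg] at this
  exact ne_neg_of_mem_unit_sphere ℝ _ this

theorem systole_le_greatLoop {g₀ g : SurfaceMetric RP2} {φ : RP2 ≃ₘ^∞⟮𝓡 2, 𝓡 2⟯ RP2}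
    (hg₀ : IsRoundVia g₀ φ) {f : RP2 → ℝ} (hf : ∀ x, 0 < f x)
    (hg : ∀ (x : RP2) (v w : TangentSpace (𝓡 2) x), g.inner x v w = f x ^ 2 * g₀.inner x v w)
    (R : E3 ≃ₗᵢ[ℝ] E3) :
    g.systole ≤ ∫⁻ t in Ioo (0 : ℝ) 1,
      ENNReal.ofReal (f (cover φ (sphereMap R (greatCircle t))) * Real.pi) := by
  have hle : g.systole ≤ g.pathLength (greatLoop φ R) :=
    (iInf_le _ _).trans <| (iInf_le _ _).trans <| (iInf_le _ (contMDiffOn_greatLoop φ R)).trans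
      (iInf_le _ (not_homotopic_greatLoop φ R))
  refine hle.trans_eq ?_
  rw [SurfaceMetric.pathLength_eq]
  refine setLIntegral_congr_fun measurableSet_Ioo fun t ht => ?_
  have hev : (greatLoop φ R).extend =ᶠ[𝓝 t] cover φ ∘ fun t => sphereMap R (greatCircle t) := by
    filter_upwards [Ioo_mem_nhds ht.1 ht.2] with s hs
    exact greatLoop_extend φ R ⟨hs.1.le, hs.2.le⟩
  rw [SurfaceMetric.speed_of_conformal hf hg, hg₀.speed_eq
    ((contMDiff_sphereMap_greatCircle R).mdifferentiable one_ne_zero t) hev,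
    norm_deriv_sphereMap_greatCircle, greatLoop_extend φ R ⟨ht.1.le, ht.2.le⟩]

/-! ### Round length of noncontractible loops is at least π -/

/-- A curve on the unit sphere joining two antipodal points has length at least `π`. -/
theorem pi_le_length_of_antipodal {Γ : ℝ → E3} {b : ℝ}
    (hb : 0 ≤ b) (hn : ∀ t, ‖Γ t‖ = 1) (hc : ContinuousOn Γ (Icc 0 b))
    (hd : ∀ t ∈ Ioo 0 b, DifferentiableAt ℝ Γ t) (h : Γ b = -Γ 0) :
    ENNReal.ofReal Real.pi ≤ ∫⁻ t in Ioo 0 b, ENNReal.ofReal ‖deriv Γ t‖ := by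
  by_cases hfin : ∫⁻ t in Ioo 0 b, ENNReal.ofReal ‖deriv Γ t‖ = ⊤
  · rw [hfin]; exact le_top
  have hint : IntegrableOn (fun t => ‖deriv Γ t‖) (Ioo 0 b) := by
    refine ⟨?_, ?_⟩
    · exact (measurable_deriv Γ).norm.aestronglyMeasurable
    · rw [hasFiniteIntegral_iff_norm]
      simpa [norm_norm] using lt_top_iff_ne_top.2 hfin
  rw [← ofReal_integral_eq_lintegral_ofReal hint
    (Filter.Eventually.of_forall fun t => norm_nonneg _)]
  refine ENNReal.ofReal_le_ofReal ?_
  set u : ℝ → ℝ := fun t => inner ℝ (Γ 0) (Γ t) with hu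
  have hu1 : ∀ t, |u t| ≤ 1 := fun t => by
    simpa [hn] using abs_real_inner_le_norm (Γ 0) (Γ t)
  -- As the velocity is orthogonal to `Γ t`, only the tangential part of `Γ 0` matters; it has
  -- squared norm 1 - u², and Cauchy–Schwarz applies.
  have hbound : ∀ t ∈ Ioo 0 b, inner ℝ (Γ 0) (deriv Γ t) ^ 2 ≤ (1 - u t ^ 2) * ‖deriv Γ t‖ ^ 2 := by
    intro t ht
    have h1 := (hd t ht).hasDerivAt.inner ℝ (hd t ht).hasDerivAt
    have h2 : (fun t => inner ℝ (Γ t) (Γ t)) = fun _ => (1 : ℝ) := by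
      ext t; rw [real_inner_self_eq_norm_sq, hn]; norm_num
    rw [h2] at h1
    have h3 := h1.unique (hasDerivAt_const t (1 : ℝ))
    rw [real_inner_comm (Γ t)] at h3
    have h4 : inner ℝ (Γ t) (deriv Γ t) = 0 := by linarith
    have h5 : inner ℝ (Γ 0) (deriv Γ t) = inner ℝ (Γ 0 - u t • Γ t) (deriv Γ t) := by
      rw [inner_sub_left, inner_smul_left, h4]; simp
    have h6 : ‖Γ 0 - u t • Γ t‖ ^ 2 = 1 - u t ^ 2 := by
      rw [norm_sub_sq_real, inner_smul_right, norm_smul, hn, hn]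
      simp [hu]; ring
    rw [h5, ← h6, ← mul_pow]
    exact sq_le_sq' (neg_le_of_abs_le (abs_real_inner_le_norm _ _)) (real_inner_le_norm _ _)
  -- The natural function arcsin u is 1-Lipschitz in arc length and runs from π/2 to -π/2, but
  -- arcsin is not differentiable at ±1. Damping u by a factor s < 1 avoids the endpoints; s → 1
  -- gives π.
  have key : ∀ s ∈ Ioo (0 : ℝ) 1, 2 * Real.arcsin s ≤ ∫ t in Ioo 0 b, ‖deriv Γ t‖ := by
    intro s hs
    have hsu : ∀ t, -1 < s * u t ∧ s * u t < 1 := fun t => by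
      rw [← abs_lt, abs_mul, abs_of_pos hs.1]
      nlinarith [hu1 t, hs.1, hs.2, abs_nonneg (u t)]
    set F : ℝ → ℝ := fun t => Real.arcsin (s * u t) with hF
    have hFd : ∀ t ∈ Ioo 0 b, HasDerivAt F
        (1 / √(1 - (s * u t) ^ 2) * (s * inner ℝ (Γ 0) (deriv Γ t))) t := fun t ht => by
      have h1 : HasDerivAt u (inner ℝ (Γ 0) (deriv Γ t)) t := by
        simpa using (hasDerivAt_const t (Γ 0)).inner ℝ (hd t ht).hasDerivAt
      exact (Real.hasDerivAt_arcsin (hsu t).1.ne' (hsu t).2.ne).comp t (h1.const_mul s)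
    have hFb : ∀ t ∈ Ioo 0 b, ‖deriv F t‖ ≤ ‖deriv Γ t‖ := by
      intro t ht
      have hpos : 0 < 1 - (s * u t) ^ 2 := by nlinarith [hsu t]
      rw [(hFd t ht).deriv, one_div, norm_mul, norm_inv,
        inv_mul_le_iff₀ (norm_pos_iff.2 (Real.sqrt_pos.2 hpos).ne'), Real.norm_eq_abs,
        Real.norm_eq_abs, abs_of_nonneg (Real.sqrt_nonneg _)]
      refine abs_le_of_sq_le_sq ?_ (by positivity)
      rw [mul_pow, mul_pow, Real.sq_sqrt hpos.le]
      have h1 := hbound t ht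
      have h2 : s ^ 2 ≤ 1 := by nlinarith [hs.1, hs.2]
      have h3 : (1 - u t ^ 2) * s ^ 2 ≤ 1 - (s * u t) ^ 2 := by nlinarith
      nlinarith [sq_nonneg s, sq_nonneg ‖deriv Γ t‖, mul_le_mul_of_nonneg_left h1 (sq_nonneg s),
        mul_le_mul_of_nonneg_right h3 (sq_nonneg ‖deriv Γ t‖)]
    have hFc : ContinuousOn F (Icc 0 b) :=
      Real.continuous_arcsin.comp_continuousOn
        (continuousOn_const.mul (continuousOn_const.inner hc))
    have hFi : IntegrableOn (deriv F) (Ioo 0 b) :=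
      Integrable.mono' hint (measurable_deriv F).aestronglyMeasurable
        ((ae_restrict_iff' measurableSet_Ioo).2 (Filter.Eventually.of_forall hFb))
    have hftc := intervalIntegral.integral_eq_sub_of_hasDerivAt_of_le hb hFc
      (fun t ht => (hFd t ht).differentiableAt.hasDerivAt)
      ((intervalIntegrable_iff_integrableOn_Ioo_of_le hb).2 hFi)
    have h0 : F 0 = Real.arcsin s := by
      simp only [hF, hu, real_inner_self_eq_norm_sq, hn]; norm_num
    have h1 : F b = -Real.arcsin s := by
      simp only [hF, hu, h, inner_neg_right, real_inner_self_eq_norm_sq, hn]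
      norm_num
    rw [h0, h1, intervalIntegral.integral_of_le hb, integral_Ioc_eq_integral_Ioo] at hftc
    have h2 : ‖∫ t in Ioo 0 b, deriv F t‖ ≤ ∫ t in Ioo 0 b, ‖deriv Γ t‖ :=
      norm_integral_le_of_norm_le hint
        ((ae_restrict_iff' measurableSet_Ioo).2 (Filter.Eventually.of_forall hFb))
    rw [hftc, Real.norm_eq_abs, abs_le] at h2
    linarith [h2.1]
  have hlim : Filter.Tendsto (fun s => 2 * Real.arcsin s) (𝓝[<] 1) (𝓝 (2 * Real.arcsin 1)) :=
    (((Real.continuous_arcsin.const_mul 2 : Continuous _).tendsto 1).mono_left nhdsWithin_le_nhds)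
  rw [Real.arcsin_one, mul_div_cancel₀ _ two_ne_zero] at hlim
  refine le_of_tendsto hlim ?_
  filter_upwards [Ioo_mem_nhdsLT (zero_lt_one (α := ℝ))] with s hs using key s hs

/-- Scaling a nonzero vector to the unit sphere. -/
def rescale (v : E3) (hv : v ≠ 0) : S2 :=
  ⟨‖v‖⁻¹ • v, by rw [mem_sphere_zero_iff_norm, norm_smul, norm_inv, norm_norm,
    inv_mul_cancel₀ (norm_ne_zero_iff.2 hv)]⟩

/-- A loop with a closed lift that misses the antipode of its base point is contractible. -/
theorem homotopic_of_lift_ne_neg {φ : RP2 ≃ₘ^∞⟮𝓡 2, 𝓡 2⟯ RP2} {p : RP2} {γ : Path p p}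
    {Γ : C(unitInterval, S2)} (hΓ : ∀ t, cover φ (Γ t) = γ t) (h01 : Γ 1 = Γ 0)
    (hne : ∀ t, Γ t ≠ -Γ 0) : γ.Homotopic (Path.refl p) := by
  have hp : cover φ (Γ 0) = p := (hΓ 0).trans γ.source
  -- Straight segments from `Γ t` to `Γ 0`, to be projected radially to the sphere: they miss the
  -- origin unless `Γ t` is antipodal to `Γ 0`.
  set v : unitInterval × unitInterval → E3 := fun q =>
    (1 - (q.1 : ℝ)) • (Γ q.2 : E3) + (q.1 : ℝ) • (Γ 0 : E3) with hv
  have hvc : Continuous v := by fun_prop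
  have hnorm : ∀ x : S2, ‖(x : E3)‖ = 1 := fun x => mem_sphere_zero_iff_norm.1 x.2
  have hv0 : ∀ q, v q ≠ 0 := by
    intro q hq
    have h1 : (1 - (q.1 : ℝ)) • (Γ q.2 : E3) = -((q.1 : ℝ) • (Γ 0 : E3)) :=
      eq_neg_of_add_eq_zero_left hq
    have h2 := congrArg norm h1
    rw [norm_neg, norm_smul, norm_smul, hnorm, hnorm, mul_one, mul_one, Real.norm_eq_abs,
      Real.norm_eq_abs, abs_of_nonneg q.1.2.1, abs_of_nonneg (sub_nonneg.2 q.1.2.2)] at h2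
    rw [h2, ← smul_neg] at h1
    have h3 : (q.1 : ℝ) ≠ 0 := fun h => by linarith
    exact hne q.2 (Subtype.ext (smul_right_injective _ h3 h1))
  have hvx : ∀ q (x : S2), v q = x → rescale (v q) (hv0 q) = x := fun q x h =>
    Subtype.ext (by simp only [rescale, h, hnorm]; simp)
  refine ⟨⟨⟨⟨fun q => cover φ (rescale (v q) (hv0 q)), ?_⟩, fun t => ?_, fun t => ?_⟩,
    fun s t ht => ?_⟩⟩
  · refine (continuous_cover φ).comp (Continuous.subtype_mk ?_ _)
    exact (hvc.norm.inv₀ fun q => norm_ne_zero_iff.2 (hv0 q)).smul hvc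
  · change cover φ _ = γ t
    rw [hvx (0, t) (Γ t) (by simp [hv]), hΓ]
  · change cover φ _ = p
    rw [hvx (1, t) (Γ 0) (by simp [hv]), hp]
  · change cover φ _ = γ t
    have h1 : Γ t = Γ 0 := by
      rcases ht with rfl | rfl
      · rfl
      · exact h01
    rw [hvx (s, t) (Γ t) (by simp only [hv, h1, ← add_smul, sub_add_cancel, one_smul]), hΓ]

/-- The double covering lifts differentiable curves to differentiable curves. -/
theorem mdifferentiableAt_lift {φ : RP2 ≃ₘ^∞⟮𝓡 2, 𝓡 2⟯ RP2} {Γ : ℝ → S2} (hΓ : Continuous Γ)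
    {t : ℝ} (h : MDifferentiableAt 𝓘(ℝ, ℝ) (𝓡 2) (cover φ ∘ Γ) t) :
    MDifferentiableAt 𝓘(ℝ, ℝ) (𝓡 2) Γ t := by
  obtain ⟨W, s, hW, hpW, hs, hQ⟩ := exists_localSection φ (cover φ (Γ t))
  -- Here σ is the identity or the antipodal map, chosen so that σ after the smooth local section
  -- agrees with the lift at t.
  have key : ∀ σ : S2 → S2, ContMDiff (𝓡 2) (𝓡 2) 1 σ →
      (∀ x y, (x = y ∨ x = -y) → x = σ y ∨ x = -σ y) →
      Γ t = σ (s (cover φ (Γ t))) → MDifferentiableAt 𝓘(ℝ, ℝ) (𝓡 2) Γ t := by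
    intro σ hσ hor ht
    have h1 : MDifferentiableAt 𝓘(ℝ, ℝ) (𝓡 2) (σ ∘ s ∘ (cover φ ∘ Γ)) t :=
      ((hσ.mdifferentiable one_ne_zero) _).comp t
        (((hs.contMDiffAt (hW.mem_nhds hpW)).mdifferentiableAt one_ne_zero).comp t h)
    refine h1.congr_of_eventuallyEq ?_
    -- By continuity the lift stays away from the opposite sheet near t, so it coincides there with
    -- the differentiable one.
    have h2 : ∀ᶠ t' in 𝓝 t, Γ t' ≠ -(σ ∘ s ∘ (cover φ ∘ Γ)) t' :=
      (hΓ.continuousAt.prodMk h1.continuousAt.neg).eventually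
        (isClosed_diagonal.isOpen_compl.mem_nhds (by
          have := ne_neg_of_mem_unit_sphere ℝ (Γ t)
          simp only [mem_compl_iff, mem_diagonal_iff, Pi.neg_apply, Function.comp_apply]
          rwa [← ht]))
    filter_upwards [h2, (hW.preimage ((continuous_cover φ).comp hΓ)).mem_nhds hpW] with t' h3 h4
    exact (hor _ _ ((cover_eq_iff φ).1 (hQ _ h4).symm)).resolve_right h3
  rcases (cover_eq_iff φ).1 (hQ _ hpW).symm with h1 | h1
  · exact key id contMDiff_id (fun x y h => h) h1
  · exact key (fun x => -x) contMDiff_neg_sphere (fun x y h => by rwa [neg_neg, or_comm]) h1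

theorem IsRoundVia.pi_le_pathLength {g₀ : SurfaceMetric RP2} {φ : RP2 ≃ₘ^∞⟮𝓡 2, 𝓡 2⟯ RP2}
    (hg : IsRoundVia g₀ φ) {p : RP2} {γ : Path p p}
    (hγ : ContMDiffOn 𝓘(ℝ, ℝ) (𝓡 2) 1 γ.extend (Icc 0 1)) (hnc : ¬ γ.Homotopic (Path.refl p)) :
    ENNReal.ofReal Real.pi ≤ g₀.pathLength γ := by
  obtain ⟨e, rfl⟩ := cover_surjective φ p
  obtain ⟨Γ, hΓ, hΓ0⟩ := (isCoveringMap_cover φ).exists_path_lifts γ e γ.source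
  have hΓ' : ∀ t, cover φ (Γ t) = γ t := fun t => congrFun hΓ t
  -- A lift missing `-Γ 0` would have to close up, and the loop would be contractible. Only the part
  -- of the curve up to time b is needed for the length bound.
  have hex : ∃ b : unitInterval, Γ b = -Γ 0 := by
    by_contra! hne
    have h1 : cover φ (Γ 1) = cover φ (Γ 0) := by rw [hΓ', hΓ', γ.source, γ.target]
    exact hnc (homotopic_of_lift_ne_neg hΓ' (((cover_eq_iff φ).1 h1).resolve_right (hne 1)) hne)
  obtain ⟨b, hb⟩ := hex
  set G : ℝ → S2 := IccExtend zero_le_one Γ with hG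
  have hGc : Continuous G := Γ.continuous.Icc_extend'
  have hGγ : γ.extend = cover φ ∘ G := by
    ext t
    exact (hΓ' _).symm
  have hmd : ∀ t ∈ Ioo (0 : ℝ) 1, MDifferentiableAt 𝓘(ℝ, ℝ) (𝓡 2) G t := fun t ht => by
    refine mdifferentiableAt_lift (φ := φ) hGc ?_
    rw [← hGγ]
    exact (hγ.contMDiffAt (Icc_mem_nhds ht.1 ht.2)).mdifferentiableAt one_ne_zero
  have hsub : Ioo (0 : ℝ) b ⊆ Ioo 0 1 := Ioo_subset_Ioo_right b.2.2
  have hGb : G b = -G 0 := by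
    rw [hG, IccExtend_of_mem _ _ b.2, IccExtend_of_mem zero_le_one Γ ⟨le_rfl, zero_le_one⟩]
    exact hb
  calc ENNReal.ofReal Real.pi
      ≤ ∫⁻ t in Ioo (0 : ℝ) b, ENNReal.ofReal ‖deriv (fun s => (G s : E3)) t‖ :=
        pi_le_length_of_antipodal b.2.1 (fun t => mem_sphere_zero_iff_norm.1 (G t).2)
          (continuous_subtype_val.comp hGc).continuousOn
          (fun t ht => (IsRoundVia.differentiableAt_coe_comp (hmd t (hsub ht))).1)
          (by rw [hGb]; rfl)
    _ = ∫⁻ t in Ioo (0 : ℝ) b, ENNReal.ofReal (g₀.speed γ.extend t) :=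
        setLIntegral_congr_fun measurableSet_Ioo fun t ht => by
          rw [hg.speed_eq (hmd t (hsub ht)) (Filter.EventuallyEq.of_eq hGγ)]
    _ ≤ g₀.pathLength γ := by
        rw [SurfaceMetric.pathLength_eq]
        exact lintegral_mono_set hsub

theorem mul_pi_le_systole_of_const {g₀ g : SurfaceMetric RP2} {φ : RP2 ≃ₘ^∞⟮𝓡 2, 𝓡 2⟯ RP2}
    (hg₀ : IsRoundVia g₀ φ) {f : RP2 → ℝ} (hf : ∀ x, 0 < f x)
    (hg : ∀ (x : RP2) (v w : TangentSpace (𝓡 2) x), g.inner x v w = f x ^ 2 * g₀.inner x v w)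
    {c : ℝ} (hc : ∀ x, f x = c) : ENNReal.ofReal (c * Real.pi) ≤ g.systole := by
  refine le_iInf fun p => le_iInf fun γ => le_iInf fun hγ => le_iInf fun hnc => ?_
  have hc0 : 0 ≤ c := hc p ▸ (hf p).le
  have h1 : g.pathLength γ = ENNReal.ofReal c * g₀.pathLength γ := by
    rw [SurfaceMetric.pathLength_eq, SurfaceMetric.pathLength_eq,
      ← lintegral_const_mul' _ _ ENNReal.ofReal_ne_top]
    refine lintegral_congr fun t => ?_
    rw [SurfaceMetric.speed_of_conformal hf hg, hc, ENNReal.ofReal_mul hc0]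
  rw [h1, ENNReal.ofReal_mul hc0]
  gcongr
  exact hg₀.pi_le_pathLength hγ hnc

/-! ### The upper bound on the systole, and rigidity -/

namespace IsRoundVia

variable {g₀ : SurfaceMetric RP2} {φ : RP2 ≃ₘ^∞⟮𝓡 2, 𝓡 2⟯ RP2}

theorem isProbabilityMeasure_normalizedArea (hg : IsRoundVia g₀ φ) :
    IsProbabilityMeasure (normalizedArea g₀) := by
  refine ⟨?_⟩
  rw [normalizedArea, hg.area_eq, Measure.smul_apply, coverArea_univ, smul_eq_mul,
    ← ENNReal.ofReal_mul (by positivity), one_div_mul_cancel (by positivity), ENNReal.ofReal_one]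

theorem area_eq_smul_normalizedArea (g₀ : SurfaceMetric RP2) :
    g₀.area = ENNReal.ofReal (2 * Real.pi) • normalizedArea g₀ := by
  rw [normalizedArea, smul_smul, ← ENNReal.ofReal_mul (by positivity),
    mul_one_div_cancel (by positivity),
    ENNReal.ofReal_one, one_smul]

theorem map_sphereArea (hg : IsRoundVia g₀ φ) :
    sphereArea.map (cover φ) = ENNReal.ofReal (4 * Real.pi) • normalizedArea g₀ := by
  have h : sphereArea.map (cover φ) = (2 : ℝ≥0∞) • coverArea φ := by
    rw [coverArea, smul_smul, ENNReal.mul_inv_cancel two_ne_zero ENNReal.ofNat_ne_top, one_smul]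
  rw [h, ← hg.area_eq, area_eq_smul_normalizedArea, smul_smul, ← ENNReal.ofReal_ofNat 2,
    ← ENNReal.ofReal_mul two_pos.le]
  congr 2
  ring

/-- Every isometric copy of the semicircle bounds the systole, so averaging does too; the total mass
4π of the sphere then cancels on both sides. -/
theorem systole_le (hg₀ : IsRoundVia g₀ φ) {g : SurfaceMetric RP2} {f : RP2 → ℝ} (hf : ∀ x, 0 < f x)
    (hg : ∀ (x : RP2) (v w : TangentSpace (𝓡 2) x), g.inner x v w = f x ^ 2 * g₀.inner x v w)
    (hi : Integrable f (normalizedArea g₀)) :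
    g.systole ≤ ENNReal.ofReal (Real.pi * ∫ x, f x ∂normalizedArea g₀) := by
  have hc := SurfaceMetric.continuous_of_conformal hf hg
  have h1 := mul_le_lintegral_sphereArea
    (F := fun x => ENNReal.ofReal (f (cover φ x) * Real.pi))
    ((hc.comp (continuous_cover φ)).mul_const Real.pi).measurable.ennreal_ofReal
    continuous_greatCircle (systole_le_greatLoop hg₀ hf hg)
  have h2 : ∫⁻ x, ENNReal.ofReal (f (cover φ x) * Real.pi) ∂sphereArea =
      ∫⁻ y, ENNReal.ofReal (f y * Real.pi) ∂sphereArea.map (cover φ) :=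
    (lintegral_map (hc.mul_const Real.pi).measurable.ennreal_ofReal
      (continuous_cover φ).measurable).symm
  rw [h2, hg₀.map_sphereArea, lintegral_smul_measure, sphereArea, toSphere_univ, smul_eq_mul,
    ENNReal.mul_le_mul_iff_right (ENNReal.ofReal_pos.2 (by positivity)).ne' ENNReal.ofReal_ne_top,
    ← ofReal_integral_eq_lintegral_ofReal (hi.mul_const _)
      (Filter.Eventually.of_forall fun x => mul_nonneg (hf x).le Real.pi_pos.le),
    integral_mul_const, mul_comm] at h1
  exact h1

/-- On the sphere, nonempty open sets have positive measure, so continuous functions equal almost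
everywhere are equal; surjectivity of the covering carries this down. -/
theorem eq_const_of_ae_eq (hg : IsRoundVia g₀ φ) {f : RP2 → ℝ} (hf : Continuous f) {c : ℝ}
    (h : ∀ᵐ x ∂normalizedArea g₀, f x = c) (x : RP2) : f x = c := by
  have h1 : ∀ᵐ y ∂sphereArea.map (cover φ), f y = c := by
    rw [hg.map_sphereArea]
    exact Measure.ae_smul_measure h _
  have h2 : (f ∘ cover φ) =ᵐ[sphereArea] fun _ => c :=
    ae_of_ae_map (continuous_cover φ).measurable.aemeasurable h1
  have : sphereArea.IsOpenPosMeasure := by unfold sphereArea; infer_instance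
  obtain ⟨y, rfl⟩ := cover_surjective φ x
  exact congrFun ((hf.comp (continuous_cover φ)).ae_eq_iff_eq sphereArea continuous_const |>.1 h2) y

end IsRoundVia

end

theorem theorem2p5 (g₀ g : SurfaceMetric RP2) (hg₀ : IsRound g₀)
    (f : RP2 → ℝ) (hf : ∀ x, 0 < f x)
    (hg : ∀ (x : RP2) (v w : TangentSpace (𝓡 2) x),
      g.inner x v w = f x ^ 2 * g₀.inner x v w) :
    g.area univ ≠ ⊤ ∧ g.systole ≠ ⊤ ∧
    IsProbabilityMeasure (normalizedArea g₀) ∧ MemLp f 2 (normalizedArea g₀) ∧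
    g.area.real univ - 2 * g.systole.toReal ^ 2 / Real.pi ≥
      2 * Real.pi * ProbabilityTheory.variance f (normalizedArea g₀) ∧
    (g.area.real univ = 2 * g.systole.toReal ^ 2 / Real.pi ↔ ∃ c : ℝ, ∀ x, f x = c) := by
  obtain ⟨φ, hφ⟩ := hg₀
  have hr : IsRoundVia g₀ φ := hφ
  have hprob := hr.isProbabilityMeasure_normalizedArea
  have hc : Continuous f := SurfaceMetric.continuous_of_conformal hf hg
  have hLp : MemLp f 2 (normalizedArea g₀) := by
    obtain ⟨C, hC⟩ := isCompact_univ.exists_bound_of_continuousOn hc.continuousOn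
    exact MemLp.of_bound hc.aestronglyMeasurable C
      (Filter.Eventually.of_forall fun x => hC x (mem_univ x))
  have hi : Integrable f (normalizedArea g₀) := hLp.integrable one_le_two
  have hi2 : Integrable (fun x => f x ^ 2) (normalizedArea g₀) := hLp.integrable_sq
  have harea : g.area univ = ENNReal.ofReal (2 * Real.pi * ∫ x, f x ^ 2 ∂normalizedArea g₀) := by
    rw [SurfaceMetric.area_of_conformal hf hg, withDensity_apply _ .univ, Measure.restrict_univ,
      IsRoundVia.area_eq_smul_normalizedArea, lintegral_smul_measure, smul_eq_mul,
      ← ofReal_integral_eq_lintegral_ofReal hi2 (Filter.Eventually.of_forall fun x => sq_nonneg _),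
      ← ENNReal.ofReal_mul (by positivity)]
  have hsys := hr.systole_le hf hg hi
  have harea' : g.area.real univ = 2 * Real.pi * ∫ x, f x ^ 2 ∂normalizedArea g₀ := by
    rw [measureReal_def, harea, ENNReal.toReal_ofReal]
    have : 0 ≤ ∫ x, f x ^ 2 ∂normalizedArea g₀ := integral_nonneg fun x => sq_nonneg _
    positivity
  have hm : 0 ≤ ∫ x, f x ∂normalizedArea g₀ := integral_nonneg fun x => (hf x).le
  have hsys' : g.systole.toReal ≤ Real.pi * ∫ x, f x ∂normalizedArea g₀ := by
    have := ENNReal.toReal_mono ENNReal.ofReal_ne_top hsys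
    rwa [ENNReal.toReal_ofReal (by positivity)] at this
  have hvar : ProbabilityTheory.variance f (normalizedArea g₀) =
      ∫ x, f x ^ 2 ∂normalizedArea g₀ - (∫ x, f x ∂normalizedArea g₀) ^ 2 :=
    ProbabilityTheory.variance_eq_sub hLp
  have hineq : g.area.real univ - 2 * g.systole.toReal ^ 2 / Real.pi ≥
      2 * Real.pi * ProbabilityTheory.variance f (normalizedArea g₀) := by
    have h1 : g.systole.toReal ^ 2 / Real.pi ≤ Real.pi * (∫ x, f x ∂normalizedArea g₀) ^ 2 := by
      rw [div_le_iff₀ Real.pi_pos]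
      calc g.systole.toReal ^ 2 ≤ (Real.pi * ∫ x, f x ∂normalizedArea g₀) ^ 2 :=
            pow_le_pow_left₀ ENNReal.toReal_nonneg hsys' 2
        _ = _ := by ring
    rw [harea', hvar, mul_div_assoc]
    linarith
  refine ⟨harea ▸ ENNReal.ofReal_ne_top, ne_top_of_le_ne_top ENNReal.ofReal_ne_top hsys, hprob, hLp,
    hineq, fun heq => ?_, ?_⟩
  -- In the equality case the inequality leaves 2π Var(f) ≤ 0.
  · have h0 : ProbabilityTheory.variance f (normalizedArea g₀) = 0 := by
      refine le_antisymm ?_ (ProbabilityTheory.variance_nonneg _ _)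
      rw [heq, sub_self] at hineq
      exact nonpos_of_mul_nonpos_right hineq Real.two_pi_pos
    have h1 : ProbabilityTheory.evariance f (normalizedArea g₀) = 0 := by
      rw [← hLp.ofReal_variance_eq, h0, ENNReal.ofReal_zero]
    rw [ProbabilityTheory.evariance_eq_zero_iff hc.aemeasurable] at h1
    exact ⟨_, hr.eq_const_of_ae_eq hc h1⟩
  · rintro ⟨c, hfc⟩
    have hint : ∫ x, f x ∂normalizedArea g₀ = c := by simp [hfc]
    have hint2 : ∫ x, f x ^ 2 ∂normalizedArea g₀ = c ^ 2 := by simp [hfc]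
    have h1 : g.systole.toReal = c * Real.pi := by
      refine le_antisymm (by rwa [hint, mul_comm] at hsys') ?_
      exact (ENNReal.ofReal_le_iff_le_toReal (ne_top_of_le_ne_top ENNReal.ofReal_ne_top hsys)).1
        (mul_pi_le_systole_of_const hr hf hg hfc)
    rw [harea', hint2, h1]
    field_simp
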